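/- For real $w,z$ put $\binom{w}{z}=\frac{\Gamma(w+1)}{\Gamma(z+1)\Gamma(w-z+1)}$ (read as $0$ if the denominator has a pole). For $z\in\mathbb{C}\setminus\{0\}$ and $\beta\in\mathbb{R}$ let $z^\beta=|z|^\beta e^{i\beta\theta}$, where $\theta\in(-\pi,\pi]$ is the argument of $z$, and let $0^\beta=0$ for $\beta>0$. For $\alpha>0$ let $K_\alpha=\{\omega\in\mathbb{C}\setminus\{0\}:\omega^\alpha=1\}$, which is a finite set. Let $\alpha>0$, $n\in\mathbb{N}=\{1,2,3,\dots\}$ and $0<\lambda\le 1$. Then $$\alpha\sum_{j=0}^n\binom{\alpha n}{\alpha j}\lambda^{\alpha j}=\sum_{\omega\in K_\alpha}(1+\lambda\omega)^{\alpha n}-R(\alpha,n,\lambda),$$ where $R(\alpha,n,\lambda)=0$ if $\alpha/2\in\mathbb{N}$, and otherwise $$R(\alpha,n,\lambda)=\frac{\alpha\lambda^\alpha\sin(\alpha\pi)}{\pi}\int_0^1 t^{\alpha-1}(1-t)^{\alpha n}\left\{\frac{1}{|t^\alpha-\lambda^\alpha e^{-i\alpha\pi}|^2}+\frac{\lambda^{\alpha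 n}}{|e^{-i\alpha\pi}-(\lambda t)^\alpha|^2}\right\}dt,$$ the integral being convergent. In particular, $\sum_{\omega\in K_\alpha}(1+\lambda\omega)^{\alpha n}$ is a real number, and the difference $$\alpha\sum_{j=0}^n\binom{\alpha n}{\alpha j}\lambda^{\alpha j}-\sum_{\omega\in K_\alpha}(1+\lambda\omega)^{\alpha n}$$ is negative if $2m<\alpha<2m+1$ for some integer $m\ge 0$, zero if $\alpha\in\mathbb{N}$, and positive if $2m+1<\alpha<2m+2$ for some integer $m\ge 0$. -/

import Mathlib

open Real MeasureTheory

noncomputable section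

/-- The generalised binomial coefficient `Γ(w+1) / (Γ(z+1) Γ(w-z+1))` for real arguments.
`Real.Gamma` takes the value `0` at its poles and `x / 0 = 0`, so the coefficient is `0` whenever
the denominator has a pole. -/
def gammaChoose (w z : ℝ) : ℝ :=
  Real.Gamma (w + 1) / (Real.Gamma (z + 1) * Real.Gamma (w - z + 1))

/-- The set `K_α` of all complex numbers `ω ≠ 0` with `ω ^ α = 1`, where the power is the principal
one: the argument of `ω` is taken in `(-π, π]`. -/
def unitPowerRoots (α : ℝ) : Set ℂ :=
  {ω : ℂ | ω ≠ 0 ∧ ω ^ (α : ℂ) = 1}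

theorem norm_eq_one_of_mem_unitPowerRoots {α : ℝ} (hα : 0 < α) {ω : ℂ}
    (hω : ω ∈ unitPowerRoots α) : ‖ω‖ = 1 := by
  have h := congrArg norm hω.2
  rw [Complex.norm_cpow_real, norm_one] at h
  have h2 := congrArg (fun x : ℝ => x ^ α⁻¹) h
  simpa [Real.rpow_rpow_inv (norm_nonneg ω) hα.ne'] using h2

/-- The explicit description `K_α = {e^{iθ} | -π < θ ≤ π and e^{iθα} = 1}`. -/
theorem mem_unitPowerRoots_iff {α : ℝ} (hα : 0 < α) (ω : ℂ) :
    ω ∈ unitPowerRoots α ↔ ∃ θ : ℝ, -π < θ ∧ θ ≤ π ∧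
      ω = Complex.exp (θ * Complex.I) ∧ Complex.exp (θ * α * Complex.I) = 1 := by
  constructor
  · intro hω
    have hn := norm_eq_one_of_mem_unitPowerRoots hα hω
    refine ⟨ω.arg, Complex.neg_pi_lt_arg ω, Complex.arg_le_pi ω, ?_, ?_⟩
    · have h := Complex.norm_mul_exp_arg_mul_I ω
      rw [hn] at h
      simpa using h.symm
    · have h := hω.2
      rw [Complex.cpow_def_of_ne_zero hω.1, Complex.log, hn] at h
      rw [← h]
      congr 1
      simp
      ring
  · rintro ⟨θ, h1, h2, rfl, h⟩
    refine ⟨Complex.exp_ne_zero _, ?_⟩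
    rw [Complex.cpow_def_of_ne_zero (Complex.exp_ne_zero _),
      Complex.log_exp (by simpa using h1) (by simpa using h2), ← h]
    congr 1
    ring

/-- `K_α` is finite, so that sums over it are genuine finite sums. -/
theorem unitPowerRoots_finite {α : ℝ} (hα : 0 < α) : (unitPowerRoots α).Finite := by
  refine ((Set.finite_Icc (-⌈α⌉) ⌈α⌉).image
    (fun k : ℤ => Complex.exp (((k * (2 * π) / α : ℝ) : ℂ) * Complex.I))).subset ?_
  intro ω hω
  obtain ⟨θ, h1, h2, rfl, h⟩ := (mem_unitPowerRoots_iff hα ω).1 hω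
  obtain ⟨k, hk⟩ := Complex.exp_eq_one_iff.1 h
  have hk' : θ * α = k * (2 * π) := by
    have := congrArg Complex.im hk
    simpa using this
  have hpi := Real.pi_pos
  have hc := Int.le_ceil α
  refine ⟨k, ⟨?_, ?_⟩, ?_⟩
  · have : (-(⌈α⌉ : ℤ) : ℝ) ≤ k := by nlinarith
    exact_mod_cast this
  · have : (k : ℝ) ≤ ⌈α⌉ := by nlinarith
    exact_mod_cast this
  · have : (k * (2 * π) / α : ℝ) = θ := by
      rw [← hk']; field_simp
    simp only [this]

/-- The sum `∑_{ω ∈ K_α} (1 + λ ω) ^ (α n)` with principal complex powers; here `l` stands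
for `λ`. -/
def unitPowerRootSum (α : ℝ) (n : ℕ) (l : ℝ) : ℂ :=
  ∑ᶠ ω ∈ unitPowerRoots α, (1 + (l : ℂ) * ω) ^ ((α * n : ℝ) : ℂ)

/-- The left-hand side `α ∑_{j=0}^n binom(α n, α j) λ ^ (α j)`. -/
def fracBinomSum (α : ℝ) (n : ℕ) (l : ℝ) : ℝ :=
  α * ∑ j ∈ Finset.range (n + 1), gammaChoose (α * n) (α * j) * l ^ (α * j)

/-- The integrand
`t^(α-1) (1-t)^(α n) {1 / |t^α - λ^α e^{-iαπ}|² + λ^(α n) / |e^{-iαπ} - (λ t)^α|²}`. -/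
def errorIntegrand (α : ℝ) (n : ℕ) (l t : ℝ) : ℝ :=
  t ^ (α - 1) * (1 - t) ^ (α * n) *
    (1 / ‖((t ^ α : ℝ) : ℂ) - ((l ^ α : ℝ) : ℂ) * Complex.exp (-(Complex.I * α * π))‖ ^ 2
      + l ^ (α * n) /
        ‖Complex.exp (-(Complex.I * α * π)) - (((l * t) ^ α : ℝ) : ℂ)‖ ^ 2)

open Classical in
/-- The error term, which is zero by convention if `α / 2` is a positive integer. -/
def errorTerm (α : ℝ) (n : ℕ) (l : ℝ) : ℝ :=
  if ∃ k : ℕ, 1 ≤ k ∧ α / 2 = k then 0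
  else α * l ^ α * Real.sin (α * π) / π * ∫ t in (0 : ℝ)..1, errorIntegrand α n l t

end

/-! Let b = αn. The coefficients binom(b, s) with real s ≤ b are Fourier integrals: (1/2π) ∫ (1 +
e^{iy})^b e^{-isy} dy over [-π, π] (`fourierOnePlus_eq_gammaChoose`). For s < 0, Cauchy's theorem
turns this integral into a Beta integral along the slit; continuity gives s = 0, and a recurrence in
s, shared by both sides, gives the rest.

Putting this into the sum over j leaves a geometric series with ratio q = λ^α z^{-α} on the circle z
= e^{iy}. For λ < 1 the denominator does not vanish there. The two ends of the series give two
integrals of (1 + z)^b against α z^α / (z^α - μ^α), one with μ = λ and one with μ = 1/λ. The second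
arises from the reflection (1 + z)^b z^{-b} = (1 + 1/z)^b, which applies because the last exponent
αn equals b (`fracBinomSum_eq_circleKernelIntegral`).

Each integral is then moved onto the slit (-1, 0) (`circleKernelIntegral_eq`). In the coordinate w =
log z the slit disc is a half strip of height 2π, and every branch of a power becomes an entire
exponential. The poles have modulus μ: for μ = λ they are the points λω with ω in K_α, with residues
(1 + λω)^b, and for μ = 1/λ there are none. The factor (1 + z)^b takes the same value on both edges
of the slit, so only the kernel jumps; its jump is a multiple of sin(απ) and gives the error
integral.

This needs e^{iαπ} ≠ 1, so that no pole lies on the slit; hence the recurring hypothesis cos(απ) ≠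
1. It fails only for even integers α, where the binomial theorem and orthogonality of roots of unity
give the identity directly (`fracBinomSum_natCast`). The case λ = 1 follows by continuity in λ. The
integrand is positive on (0, 1), so the sign of the difference is that of -sin(απ). -/

/-! ### Cauchy's theorem and residues in the half strip -/

/-- The closed half strip which the exponential function wraps around the slit unit disc. -/
def closedHalfStrip : Set ℂ := {w | w.re ≤ 0 ∧ |w.im| ≤ π}

/-- The interior of the half strip. -/
def openHalfStrip : Set ℂ := {w | w.re < 0 ∧ |w.im| < π}

theorem isOpen_openHalfStrip : IsOpen openHalfStrip :=
  (isOpen_lt Complex.continuous_re continuous_const).inter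
    (isOpen_lt Complex.continuous_im.abs continuous_const)

theorem openHalfStrip_subset_closedHalfStrip : openHalfStrip ⊆ closedHalfStrip :=
  fun _ h => ⟨h.1.le, h.2.le⟩

theorem exists_le_of_eventually_comap_re {p : ℂ → Prop}
    (h : ∀ᶠ w in Filter.comap Complex.re Filter.atBot, p w) :
    ∃ M : ℝ, ∀ w : ℂ, w.re ≤ M → p w := by
  obtain ⟨t, ht, hts⟩ := Filter.mem_comap.1 h
  obtain ⟨M, hM⟩ := Filter.mem_atBot_sets.1 ht
  exact ⟨M, fun w hw => hts (hM _ hw)⟩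

/-- Vertical integrals of a function decaying at `re = -∞` tend to zero. -/
theorem tendsto_vertical_integral {f : ℂ → ℂ}
    (h0 : Filter.Tendsto f (Filter.comap Complex.re Filter.atBot) (nhds 0)) (a b : ℝ) :
    Filter.Tendsto (fun x : ℝ => ∫ y in a..b, f (x + y * Complex.I)) Filter.atBot (nhds 0) := by
  rw [Metric.tendsto_nhds]
  intro ε hε
  have hd : 0 < ε / (|b - a| + 1) := by positivity
  obtain ⟨M, hM⟩ := exists_le_of_eventually_comap_re ((Metric.tendsto_nhds.1 h0) _ hd)
  filter_upwards [Filter.eventually_le_atBot M] with x hx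
  rw [dist_zero_right]
  calc ‖∫ y in a..b, f (x + y * Complex.I)‖ ≤ ε / (|b - a| + 1) * |b - a| := by
        apply intervalIntegral.norm_integral_le_of_norm_le_const
        intro y _
        have := hM (x + y * Complex.I) (by simpa using hx)
        rw [dist_zero_right] at this
        exact this.le
    _ < ε := by
        rw [div_mul_eq_mul_div, div_lt_iff₀ (by positivity)]
        nlinarith [abs_nonneg (b - a)]

/-- Cauchy's theorem for the half strip: the integral along the vertical side is expressed by the
jump between the horizontal sides. -/
theorem integral_halfStrip_side {f : ℂ → ℂ} {g : ℝ → ℂ}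
    (hc : ContinuousOn f closedHalfStrip) (hd : DifferentiableOn ℂ f openHalfStrip)
    (h0 : Filter.Tendsto f (Filter.comap Complex.re Filter.atBot) (nhds 0))
    (hg : ContinuousOn g (Set.Ioc 0 1)) (hgi : IntervalIntegrable g volume 0 1)
    (hfg : ∀ x : ℝ, x ≤ 0 → f (x + π * Complex.I) - f (x - π * Complex.I)
      = Real.exp x * g (Real.exp x)) :
    ∫ y in (-π)..π, f (y * Complex.I) = -Complex.I * ∫ t in (0 : ℝ)..1, g t := by
  have hpi := Real.pi_pos
  have key : ∀ x : ℝ, x ≤ 0 →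
      (∫ y in (-π)..π, f (x + y * Complex.I)) - (∫ y in (-π)..π, f (y * Complex.I))
        = Complex.I * ∫ t in (Real.exp x)..1, g t := by
    intro x hx
    have hsub : (Set.uIcc x 0 ×ℂ Set.uIcc (-π) π) ⊆ closedHalfStrip := by
      intro w hw
      rw [Complex.mem_reProdIm, Set.uIcc_of_le hx, Set.uIcc_of_le (by linarith)] at hw
      exact ⟨hw.1.2, abs_le.2 hw.2⟩
    -- Cauchy on the rectangle [x, 0] × [-π, π]; the left side disappears later as x → -∞.
    have h := Complex.integral_boundary_rect_eq_zero_of_continuousOn_of_differentiableOn f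
      ⟨x, -π⟩ ⟨0, π⟩ (hc.mono hsub) (hd.mono (by
        intro w hw
        rw [Complex.mem_reProdIm] at hw
        simp only [min_eq_left hx, max_eq_right hx, min_eq_left (by linarith : -π ≤ π),
          max_eq_right (by linarith : -π ≤ π)] at hw
        exact ⟨hw.1.2, abs_lt.2 hw.2⟩))
    simp only [smul_eq_mul, Complex.ofReal_neg, Complex.ofReal_zero, zero_add] at h
    have hint : ∀ s : ℝ, |s| = π → IntervalIntegrable
        (fun t : ℝ => f (t + s * Complex.I)) volume x 0 := by
      intro s hs
      apply ContinuousOn.intervalIntegrable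
      refine hc.comp (by fun_prop) ?_
      intro t ht
      rw [Set.uIcc_of_le hx] at ht
      exact ⟨by simpa using ht.2, by simp [hs]⟩
    have h1 := hint π (abs_of_pos hpi)
    have h2 := hint (-π) (by rw [abs_neg, abs_of_pos hpi])
    have hdiff : (∫ t in x..0, f (t + π * Complex.I)) - ∫ t in x..0, f (t + -π * Complex.I)
        = ∫ t in (Real.exp x)..1, g t := by
      have h2' : IntervalIntegrable (fun t : ℝ => f (t + -π * Complex.I)) volume x 0 := by
        simpa using h2
      rw [← intervalIntegral.integral_sub h1 h2']
      -- The substitution t = e^x parametrises the slit by its distance from 0.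
      have hcv := intervalIntegral.integral_deriv_smul_comp'' (a := x) (b := 0) (f := Real.exp)
        (f' := Real.exp) (g := g) Real.continuous_exp.continuousOn
        (fun t _ => (Real.hasDerivAt_exp t).hasDerivWithinAt)
        Real.continuous_exp.continuousOn (hg.mono (by
          rintro _ ⟨t, ht, rfl⟩
          rw [Set.uIcc_of_le hx] at ht
          exact ⟨Real.exp_pos t, Real.exp_le_one_iff.2 ht.2⟩))
      rw [Real.exp_zero] at hcv
      rw [← hcv]
      apply intervalIntegral.integral_congr
      intro t ht
      rw [Set.uIcc_of_le hx] at ht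
      have := hfg t ht.2
      simp only [Function.comp, Complex.real_smul]
      rw [← this]
      congr 2
      ring
    rw [← hdiff]
    linear_combination Complex.I * h + (1) * ((∫ y in (-π)..π, f (x + y * Complex.I)) -
      ∫ y in (-π)..π, f (y * Complex.I)) * (Complex.I_mul_I)
  have hL := (tendsto_vertical_integral h0 (-π) π).sub_const (∫ y in (-π)..π, f (y * Complex.I))
  have hR : Filter.Tendsto (fun x : ℝ => Complex.I * ∫ t in (Real.exp x)..1, g t) Filter.atBot
      (nhds (Complex.I * ∫ t in (0 : ℝ)..1, g t)) := by
    apply Filter.Tendsto.const_mul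
    have hi : IntegrableOn g (Set.uIcc 0 1) volume := by
      rw [Set.uIcc_of_le zero_le_one, integrableOn_Icc_iff_integrableOn_Ioc]
      exact (intervalIntegrable_iff_integrableOn_Ioc_of_le zero_le_one).1 hgi
    have hcont := intervalIntegral.continuousOn_primitive_interval_left hi 0 (by simp)
    refine hcont.tendsto.comp (tendsto_nhdsWithin_iff.2 ⟨Real.tendsto_exp_atBot, ?_⟩)
    filter_upwards [Filter.eventually_le_atBot 0] with x hx
    rw [Set.uIcc_of_le zero_le_one]
    exact ⟨(Real.exp_pos x).le, Real.exp_le_one_iff.2 hx⟩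
  have hE : (fun x : ℝ => (∫ y in (-π)..π, f (x + y * Complex.I)) -
      ∫ y in (-π)..π, f (y * Complex.I)) =ᶠ[Filter.atBot]
      fun x => Complex.I * ∫ t in (Real.exp x)..1, g t := by
    filter_upwards [Filter.eventually_le_atBot 0] with x hx using key x hx
  have := tendsto_nhds_unique (hL.congr' hE) hR
  linear_combination -this

/-- The integral over a period of the function with simple poles at `s + 2πik` and residue one. -/
theorem integral_exp_div_exp_sub {s : ℂ} (hs : s.re < 0) :
    ∫ y in (-π)..π, Complex.exp (y * Complex.I) / (Complex.exp (y * Complex.I) - Complex.exp s)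
      = 2 * π := by
  have h := circleIntegral.integral_sub_inv_of_mem_ball (c := 0) (w := Complex.exp s) (R := 1)
    (by simpa [Complex.norm_exp] using hs)
  rw [circleIntegral] at h
  have hper : Function.Periodic (fun y : ℝ => Complex.exp (y * Complex.I) /
      (Complex.exp (y * Complex.I) - Complex.exp s)) (2 * π) := by
    intro y
    have : Complex.exp (((y + 2 * π : ℝ) : ℂ) * Complex.I) = Complex.exp (y * Complex.I) := by
      push_cast
      rw [add_mul, Complex.exp_add, Complex.exp_two_pi_mul_I, mul_one]
    simp only [this]
  -- The circle integral runs over [0, 2π]; periodicity moves it to [-π, π].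
  have hp := hper.intervalIntegral_add_eq (-π) 0
  rw [show -π + 2 * π = π by ring, zero_add] at hp
  rw [hp]
  apply mul_left_cancel₀ Complex.I_ne_zero
  rw [← intervalIntegral.integral_const_mul]
  rw [show Complex.I * (2 * (π : ℂ)) = 2 * π * Complex.I by ring, ← h]
  apply intervalIntegral.integral_congr
  intro y _
  simp [circleMap, deriv_circleMap]
  ring

/-- The simple pole of `c e^{cw} / (e^{cw} - e^{cs})` at `s` has residue one. -/
theorem tendsto_mul_exp_div_exp_sub {c : ℂ} (hc : c ≠ 0) (s : ℂ) :
    Filter.Tendsto (fun w => (w - s) * (c * Complex.exp (c * w) /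
      (Complex.exp (c * w) - Complex.exp (c * s)))) (nhdsWithin s {s}ᶜ) (nhds 1) := by
  have hder : HasDerivAt (fun w => Complex.exp (c * w)) (Complex.exp (c * s) * c) s := by
    simpa using ((hasDerivAt_id s).const_mul c).cexp
  have h1 := hasDerivAt_iff_tendsto_slope.1 hder
  have hne : Complex.exp (c * s) * c ≠ 0 := mul_ne_zero (Complex.exp_ne_zero _) hc
  have h2 : Filter.Tendsto (fun w => c * Complex.exp (c * w)) (nhdsWithin s {s}ᶜ)
      (nhds (c * Complex.exp (c * s))) :=
    Filter.Tendsto.mono_left (Continuous.tendsto (by fun_prop) s) nhdsWithin_le_nhds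
  have h3 := h2.mul (h1.inv₀ hne)
  rw [mul_comm (Complex.exp (c * s)) c, mul_inv_cancel₀ (by rwa [mul_comm])] at h3
  refine h3.congr fun w => ?_
  rw [slope_def_field, inv_div]
  ring

/-- A function with finitely many removable singularities in an open set extends across them. -/
theorem exists_differentiableOn_extension {f : ℂ → ℂ} {U : Set ℂ} (hU : IsOpen U) (S : Finset ℂ)
    (hd : DifferentiableOn ℂ f (U \ S))
    (h0 : ∀ s ∈ S, Filter.Tendsto (fun w => (w - s) * f w) (nhdsWithin s {s}ᶜ) (nhds 0)) :
    ∃ h : ℂ → ℂ, (∀ w ∉ S, h w = f w) ∧ DifferentiableOn ℂ h U := by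
  classical
  refine ⟨fun w => if w ∈ S then (nhdsWithin w {w}ᶜ).limUnder f else f w,
    fun w hw => if_neg hw, ?_⟩
  intro s hs
  apply DifferentiableAt.differentiableWithinAt
  have hV : U \ (S.erase s : Finset ℂ) ∈ nhds s :=
    (hU.sdiff (S.erase s).finite_toSet.isClosed).mem_nhds ⟨hs, by simp⟩
  by_cases hsS : s ∈ S
  -- The removable singularity theorem is phrased with the value of f at s. That value is arbitrary
  -- here, and harmless because the factor z - s kills it.
  · have ho : (fun z => f z - f s) =o[nhdsWithin s {s}ᶜ] fun z => (z - s)⁻¹ := by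
      rw [Asymptotics.isLittleO_iff_tendsto']
      · have h1 : Filter.Tendsto (fun z => (z - s) * f s) (nhdsWithin s {s}ᶜ) (nhds 0) := by
          refine Filter.Tendsto.mono_left ?_ nhdsWithin_le_nhds
          have : Continuous fun z => (z - s) * f s := by fun_prop
          simpa using this.tendsto s
        have h2 := (h0 s hsS).sub h1
        rw [sub_zero] at h2
        refine h2.congr fun z => ?_
        rw [div_inv_eq_mul]
        ring
      · filter_upwards [self_mem_nhdsWithin] with z hz h
        exact absurd (inv_eq_zero.1 h) (sub_ne_zero.2 hz)
    have h := Complex.differentiableOn_update_limUnder_of_isLittleO hV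
      (hd.mono (by
        rintro z ⟨⟨hz1, hz2⟩, hz3⟩
        refine ⟨hz1, fun hz => hz2 ?_⟩
        simp only [Finset.coe_erase, Set.mem_sdiff]
        exact ⟨hz, hz3⟩)) ho
    refine (h.differentiableAt hV).congr_of_eventuallyEq ?_
    filter_upwards [hV] with z hz
    by_cases hzs : z = s
    · subst hzs
      simp [hsS]
    · have : z ∉ S := fun h => hz.2 (by simp [hzs, h])
      simp [this, hzs]
  · have hW : U \ (S : Set ℂ) ∈ nhds s :=
      (hU.sdiff S.finite_toSet.isClosed).mem_nhds ⟨hs, by simpa using hsS⟩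
    refine (hd.differentiableAt hW).congr_of_eventuallyEq ?_
    filter_upwards [hW] with z hz
    exact if_neg (by simpa using hz.2)

/-- The imaginary parts differ by a multiple of 2π, yet by less than 2π because one of the points is
strictly inside the strip. -/
theorem exp_eq_exp_iff_of_mem_halfStrip {s w : ℂ} (hs : s ∈ openHalfStrip)
    (hw : w ∈ closedHalfStrip) (h : Complex.exp w = Complex.exp s) : w = s := by
  have hpi := Real.pi_pos
  obtain ⟨k, hk⟩ := Complex.exp_eq_exp_iff_exists_int.1 h
  have him : w.im = s.im + k * (2 * π) := by
    rw [hk]; simp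
  have h1 := abs_lt.1 hs.2
  have h2 := abs_le.1 hw.2
  have hk1 : (-1 : ℝ) < k := by
    by_contra hc
    push Not at hc
    nlinarith
  have hk2 : (k : ℝ) < 1 := by
    by_contra hc
    push Not at hc
    nlinarith
  have hk0 : k = 0 := by
    have h3 : (-1 : ℤ) < k := by exact_mod_cast hk1
    have h4 : k < (1 : ℤ) := by exact_mod_cast hk2
    omega
  rw [hk, hk0]; simp

theorem exp_add_pi_mul_I_eq (x : ℝ) :
    Complex.exp (x + π * Complex.I) = Complex.exp (x - π * Complex.I) := by
  rw [Complex.exp_add, Complex.exp_sub, Complex.exp_pi_mul_I]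
  ring

/-- The residue theorem for the half strip. -/
theorem integral_halfStrip_side_eq_residues {f : ℂ → ℂ} {g : ℝ → ℂ} (S : Finset ℂ) (r : ℂ → ℂ)
    (hS : ∀ s ∈ S, s ∈ openHalfStrip)
    (hc : ContinuousOn f (closedHalfStrip \ S)) (hd : DifferentiableOn ℂ f (openHalfStrip \ S))
    (hr : ∀ s ∈ S, Filter.Tendsto (fun w => (w - s) * f w) (nhdsWithin s {s}ᶜ) (nhds (r s)))
    (h0 : Filter.Tendsto f (Filter.comap Complex.re Filter.atBot) (nhds 0))
    (hg : ContinuousOn g (Set.Ioc 0 1)) (hgi : IntervalIntegrable g volume 0 1)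
    (hfg : ∀ x : ℝ, x ≤ 0 → f (x + π * Complex.I) - f (x - π * Complex.I)
      = Real.exp x * g (Real.exp x)) :
    ∫ y in (-π)..π, f (y * Complex.I)
      = 2 * π * ∑ s ∈ S, r s - Complex.I * ∫ t in (0 : ℝ)..1, g t := by
  classical
  have hpi := Real.pi_pos
  -- Model pole with residue one at s. It is 2πi-periodic, so subtracting it leaves the jump between
  -- the horizontal sides unchanged, and it decays at -∞. Its integral over the vertical side is 2π.
  set B : ℂ → ℂ → ℂ := fun s w => Complex.exp w / (Complex.exp w - Complex.exp s) with hB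
  have hBne : ∀ s ∈ S, ∀ w ∈ closedHalfStrip, w ≠ s → Complex.exp w - Complex.exp s ≠ 0 :=
    fun s hs w hw hne h =>
      hne (exp_eq_exp_iff_of_mem_halfStrip (hS s hs) hw (sub_eq_zero.1 h))
  have hBd : ∀ s w, Complex.exp w - Complex.exp s ≠ 0 → DifferentiableAt ℂ (B s) w := by
    intro s w h
    exact Complex.differentiable_exp.differentiableAt.div (by fun_prop) h
  set G : ℂ → ℂ := fun w => f w - ∑ s ∈ S, r s * B s w with hG
  have hsum_d : ∀ T : Finset ℂ, ∀ w, (∀ s ∈ T, Complex.exp w - Complex.exp s ≠ 0) →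
      DifferentiableAt ℂ (fun w => ∑ s ∈ T, r s * B s w) w := by
    intro T w hw
    exact DifferentiableAt.fun_sum fun s hs => (hBd s w (hw s hs)).const_mul _
  have hGd : DifferentiableOn ℂ G (openHalfStrip \ S) := by
    intro w hw
    refine (hd w hw).sub (hsum_d S w fun s hs => ?_).differentiableWithinAt
    exact hBne s hs w (openHalfStrip_subset_closedHalfStrip hw.1) fun h => hw.2 (h ▸ hs)
  have hGc : ContinuousOn G (closedHalfStrip \ S) := by
    intro w hw
    refine (hc w hw).sub (hsum_d S w fun s hs => ?_).continuousAt.continuousWithinAt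
    exact hBne s hs w hw.1 fun h => hw.2 (h ▸ hs)
  have hGr : ∀ s ∈ S, Filter.Tendsto (fun w => (w - s) * G w) (nhdsWithin s {s}ᶜ) (nhds 0) := by
    intro s hs
    have h1 : Filter.Tendsto (fun w => (w - s) * B s w) (nhdsWithin s {s}ᶜ) (nhds 1) := by
      simpa using tendsto_mul_exp_div_exp_sub one_ne_zero s
    have h2 : Filter.Tendsto (fun w => (w - s) * ∑ t ∈ S.erase s, r t * B t w)
        (nhdsWithin s {s}ᶜ) (nhds 0) := by
      refine Filter.Tendsto.mono_left ?_ nhdsWithin_le_nhds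
      have hcont : ContinuousAt (fun w => (w - s) * ∑ t ∈ S.erase s, r t * B t w) s := by
        refine ContinuousAt.mul (by fun_prop) (hsum_d _ s fun t ht => ?_).continuousAt
        have ht' := Finset.mem_erase.1 ht
        exact hBne t ht'.2 s (openHalfStrip_subset_closedHalfStrip (hS s hs)) (Ne.symm ht'.1)
      simpa using hcont.tendsto
    have h3 := ((hr s hs).sub (h1.const_mul (r s))).sub h2
    rw [mul_one, sub_self, sub_zero] at h3
    refine h3.congr fun w => ?_
    simp only [hG]
    rw [← Finset.add_sum_erase S _ hs]
    ring
  obtain ⟨h, hh, hhd⟩ := exists_differentiableOn_extension isOpen_openHalfStrip S hGd hGr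
  have hhc : ContinuousOn h closedHalfStrip := by
    intro w hw
    by_cases hwS : w ∈ S
    · exact (hhd.differentiableAt
        (isOpen_openHalfStrip.mem_nhds (hS w hwS))).continuousAt.continuousWithinAt
    · have hn : (S : Set ℂ)ᶜ ∈ nhds w := S.finite_toSet.isClosed.isOpen_compl.mem_nhds
        (by simpa using hwS)
      have h1 : ContinuousWithinAt G closedHalfStrip w :=
        (continuousWithinAt_inter hn).1 (hGc w ⟨hw, by simpa using hwS⟩)
      refine h1.congr_of_eventuallyEq ?_ (hh w hwS)
      filter_upwards [mem_nhdsWithin_of_mem_nhds hn] with z hz using hh z (by simpa using hz)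
  have hB0 : ∀ s, Filter.Tendsto (B s) (Filter.comap Complex.re Filter.atBot) (nhds 0) := by
    intro s
    have h1 := Complex.tendsto_exp_comap_re_atBot
    have h2 := h1.div (h1.sub_const (Complex.exp s)) (by simp)
    rw [zero_div] at h2
    exact h2
  have hG0 : Filter.Tendsto G (Filter.comap Complex.re Filter.atBot) (nhds 0) := by
    have h1 := tendsto_finsetSum S fun s _ => (hB0 s).const_mul (r s)
    simpa using h0.sub h1
  have hh0 : Filter.Tendsto h (Filter.comap Complex.re Filter.atBot) (nhds 0) := by
    refine hG0.congr' ?_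
    have h1 : ∀ s ∈ S, ∀ᶠ w in Filter.comap Complex.re Filter.atBot, w ≠ s := by
      intro s _
      have := Filter.tendsto_comap.eventually (Filter.eventually_lt_atBot s.re)
        (f := Complex.re)
      filter_upwards [this] with w hw hws
      exact hw.ne (by rw [hws])
    filter_upwards [(Finset.eventually_all S).2 h1] with w hw
    exact (hh w fun hwS => hw w hwS rfl).symm
  have hbd : ∀ w : ℂ, |w.im| = π ∨ w.re = 0 → w ∉ S := by
    rintro w (hw | hw) hwS
    · exact (hS w hwS).2.ne hw
    · exact (hS w hwS).1.ne hw
  have key := integral_halfStrip_side hhc hhd hh0 hg hgi (by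
    intro x hx
    rw [hh _ (hbd _ (Or.inl (by simp [abs_of_pos hpi]))),
      hh _ (hbd _ (Or.inl (by simp [abs_of_pos hpi]))), ← hfg x hx]
    simp only [hG, hB, exp_add_pi_mul_I_eq]
    ring)
  have hline : ∀ y : ℝ, y ∈ Set.uIcc (-π) π → (y * Complex.I : ℂ) ∈ closedHalfStrip := by
    intro y hy
    rw [Set.uIcc_of_le (by linarith)] at hy
    exact ⟨by simp, by simpa using abs_le.2 hy⟩
  have hfi : IntervalIntegrable (fun y : ℝ => f (y * Complex.I)) volume (-π) π := by
    apply ContinuousOn.intervalIntegrable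
    refine hc.comp (by fun_prop) fun y hy => ⟨hline y hy, ?_⟩
    simpa using hbd (y * Complex.I) (Or.inr (by simp))
  have hBi : ∀ s ∈ S, IntervalIntegrable (fun y : ℝ => r s * B s (y * Complex.I)) volume
      (-π) π := by
    intro s hs
    apply Continuous.intervalIntegrable
    refine continuous_const.mul (Continuous.div (by fun_prop) (by fun_prop) fun y hy => ?_)
    have := congrArg norm (sub_eq_zero.1 hy)
    rw [Complex.norm_exp, Complex.norm_exp, Real.exp_eq_exp] at this
    have h1 := (hS s hs).1
    simp at this
    linarith
  have e1 : ∫ y in (-π)..π, h (y * Complex.I) = ∫ y in (-π)..π, G (y * Complex.I) :=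
    intervalIntegral.integral_congr fun y _ => hh _ (hbd _ (Or.inr (by simp)))
  rw [e1] at key
  simp only [hG] at key
  have hsumi : IntervalIntegrable (fun y : ℝ => ∑ s ∈ S, r s * B s (y * Complex.I)) volume
      (-π) π := by
    have := IntervalIntegrable.sum S hBi
    refine this.congr ?_
    intro y _
    simp
  rw [intervalIntegral.integral_sub hfi hsumi, intervalIntegral.integral_finsetSum hBi] at key
  have e2 : ∀ s ∈ S, ∫ y in (-π)..π, r s * B s (y * Complex.I) = r s * (2 * π) := by
    intro s hs
    rw [intervalIntegral.integral_const_mul, integral_exp_div_exp_sub (hS s hs).1]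
  rw [Finset.sum_congr rfl e2, ← Finset.sum_mul] at key
  linear_combination key

/-! ### The power (1 + z)^b in the logarithmic coordinate -/

/-- The function `(1 + e^w) ^ b`, that is `(1 + z) ^ b` in the logarithmic coordinate. -/
noncomputable def onePlusExpPow (b : ℝ) (w : ℂ) : ℂ := (1 + Complex.exp w) ^ (b : ℂ)

theorem re_one_add_exp_nonneg {w : ℂ} (hw : w.re ≤ 0) : 0 ≤ (1 + Complex.exp w).re := by
  have h1 := Complex.abs_re_le_norm (Complex.exp w)
  rw [Complex.norm_exp] at h1
  have h2 := (abs_le.1 h1).1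
  have h3 := Real.exp_le_one_iff.2 hw
  simp only [Complex.add_re, Complex.one_re]
  linarith

theorem one_add_exp_mem_slitPlane_of_re_neg {w : ℂ} (hw : w.re < 0) :
    1 + Complex.exp w ∈ Complex.slitPlane := by
  left
  have h1 := Complex.abs_re_le_norm (Complex.exp w)
  rw [Complex.norm_exp] at h1
  have h2 := (abs_le.1 h1).1
  have h3 := Real.exp_lt_exp.2 hw
  rw [Real.exp_zero] at h3
  simp only [Complex.add_re, Complex.one_re]
  linarith

theorem one_add_exp_mul_I_mem_slitPlane {y : ℝ} (hy : |y| < π) :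
    1 + Complex.exp (y * Complex.I) ∈ Complex.slitPlane := by
  left
  have h := abs_lt.1 hy
  rw [Complex.add_re, Complex.one_re, Complex.exp_ofReal_mul_I_re]
  have h0 : 0 < Real.cos (y / 2) := Real.cos_pos_of_mem_Ioo ⟨by linarith, by linarith⟩
  have h2 : Real.cos y = 2 * Real.cos (y / 2) ^ 2 - 1 := by
    rw [← Real.cos_two_mul]; congr 1; ring
  rw [h2]
  nlinarith

/-- The base stays in the closed right half plane, where the principal power with positive exponent
is continuous even at 0. So the branch points w = ±πi on the boundary do no harm. -/
theorem continuousAt_onePlusExpPow {b : ℝ} (hb : 0 < b) {w : ℂ} (hw : w.re ≤ 0) :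
    ContinuousAt (onePlusExpPow b) w := by
  have h1 := Complex.continuousAt_cpow_const_of_re_pos (z := 1 + Complex.exp w) (w := (b : ℂ))
    (Or.inl (re_one_add_exp_nonneg hw)) (by simpa using hb)
  exact ContinuousAt.comp (f := fun w => 1 + Complex.exp w) h1 (by fun_prop)

theorem hasDerivAt_onePlusExpPow (b : ℝ) {w : ℂ} (hw : 1 + Complex.exp w ∈ Complex.slitPlane) :
    HasDerivAt (onePlusExpPow (b + 1)) ((b + 1) * onePlusExpPow b w * Complex.exp w) w := by
  have h := ((Complex.hasDerivAt_exp w).const_add 1).cpow_const (c := ((b + 1 : ℝ) : ℂ)) hw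
  refine h.congr_deriv ?_
  simp [onePlusExpPow]

theorem differentiableAt_onePlusExpPow (b : ℝ) {w : ℂ} (hw : w.re < 0) :
    DifferentiableAt ℂ (onePlusExpPow b) w := by
  have := (hasDerivAt_onePlusExpPow (b - 1) (one_add_exp_mem_slitPlane_of_re_neg hw))
  rw [sub_add_cancel] at this
  exact this.differentiableAt

theorem tendsto_onePlusExpPow (b : ℝ) :
    Filter.Tendsto (onePlusExpPow b) (Filter.comap Complex.re Filter.atBot) (nhds 1) := by
  have h1 := Complex.tendsto_exp_comap_re_atBot.const_add 1
  have h2 : ContinuousAt (fun x : ℂ => x ^ (b : ℂ)) (1 + 0) :=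
    continuousAt_cpow_const (by simp)
  have := h2.tendsto.comp h1
  rw [add_zero, Complex.one_cpow] at this
  exact this

theorem onePlusExpPow_add_one {b : ℝ} (hb : 0 < b) (w : ℂ) :
    onePlusExpPow (b + 1) w = onePlusExpPow b w * (1 + Complex.exp w) := by
  unfold onePlusExpPow
  by_cases h : 1 + Complex.exp w = 0
  · rw [h, mul_zero, Complex.zero_cpow]
    exact_mod_cast (by linarith : b + 1 ≠ 0)
  · push_cast
    rw [Complex.cpow_add _ _ h, Complex.cpow_one]

/-- With `onePlusExpPow_sub_pi`, this shows that the power has no jump across the slit: on both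
edges the base is the same nonnegative real. -/
theorem onePlusExpPow_add_pi (b : ℝ) {x : ℝ} (hx : x ≤ 0) :
    onePlusExpPow b (x + π * Complex.I) = ((1 - Real.exp x) ^ b : ℝ) := by
  have h : 0 ≤ 1 - Real.exp x := sub_nonneg.2 (Real.exp_le_one_iff.2 hx)
  rw [Complex.ofReal_cpow h, onePlusExpPow, Complex.exp_add, Complex.exp_pi_mul_I]
  congr 1
  push_cast
  ring

theorem onePlusExpPow_sub_pi (b : ℝ) {x : ℝ} (hx : x ≤ 0) :
    onePlusExpPow b (x - π * Complex.I) = ((1 - Real.exp x) ^ b : ℝ) := by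
  rw [← onePlusExpPow_add_pi b hx, onePlusExpPow, onePlusExpPow, exp_add_pi_mul_I_eq]

theorem continuous_onePlusExpPow_mul_I {b : ℝ} (hb : 0 < b) :
    Continuous fun y : ℝ => onePlusExpPow b (y * Complex.I) := by
  rw [continuous_iff_continuousAt]
  intro y
  exact ContinuousAt.comp (f := fun y : ℝ => (y * Complex.I : ℂ))
    (continuousAt_onePlusExpPow hb (by simp)) (by fun_prop)

/-! ### Binomial coefficients as Fourier coefficients -/

/-- The Fourier integral of `(1 + e^{iy}) ^ b` at a real frequency. -/
noncomputable def fourierOnePlus (b s : ℝ) : ℂ :=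
  ∫ y in (-π)..π, onePlusExpPow b (y * Complex.I) * Complex.exp (-(s * y * Complex.I))

theorem continuous_fourierOnePlus {b : ℝ} (hb : 0 < b) : Continuous (fourierOnePlus b) := by
  apply intervalIntegral.continuous_parametric_intervalIntegral_of_continuous'
  exact ((continuous_onePlusExpPow_mul_I hb).comp continuous_snd).mul (by fun_prop)

/-- The derivative of (1 + e^{iy})^{b+1} e^{-isy} integrates to zero, because 1 + e^{iy} vanishes at
y = ±π. -/
theorem mul_fourierOnePlus {b : ℝ} (hb : 0 < b) (s : ℝ) :
    s * fourierOnePlus b s = (b + 1 - s) * fourierOnePlus b (s - 1) := by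
  have hpi := Real.pi_pos
  have hF := continuous_onePlusExpPow_mul_I hb
  have hF1 := continuous_onePlusExpPow_mul_I (by linarith : 0 < b + 1)
  have c1 : Continuous fun y : ℝ => onePlusExpPow b (y * Complex.I) *
      Complex.exp (-(s * y * Complex.I)) := hF.mul (by fun_prop)
  have c2 : Continuous fun y : ℝ => onePlusExpPow b (y * Complex.I) *
      Complex.exp (-((s - 1 : ℝ) * y * Complex.I)) := hF.mul (by fun_prop)
  have hexp : ∀ y : ℝ, Complex.exp (-((s - 1 : ℝ) * y * Complex.I)) =
      Complex.exp (y * Complex.I) * Complex.exp (-(s * y * Complex.I)) := by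
    intro y
    rw [← Complex.exp_add]
    congr 1
    push_cast
    ring
  have hi := intervalIntegral.integral_eq_sub_of_hasDerivAt_of_le (a := -π) (b := π)
    (f := fun y : ℝ => onePlusExpPow (b + 1) (y * Complex.I) *
      Complex.exp (-(s * y * Complex.I)))
    -- Product rule, after splitting (1 + e^{iy})^{b+1} as (1 + e^{iy})^b + (1 + e^{iy})^b e^{iy}.
    (f' := fun y : ℝ => Complex.I * ((b + 1 - s) *
      (onePlusExpPow b (y * Complex.I) * Complex.exp (-((s - 1 : ℝ) * y * Complex.I))) -
      s * (onePlusExpPow b (y * Complex.I) * Complex.exp (-(s * y * Complex.I)))))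
    (by linarith) (hF1.mul (by fun_prop)).continuousOn (by
      intro y hy
      have hl : HasDerivAt (fun y : ℝ => (y * Complex.I : ℂ)) Complex.I y := by
        simpa using (Complex.ofRealCLM.hasDerivAt (x := y)).mul_const Complex.I
      have h1 := (hasDerivAt_onePlusExpPow b
        (one_add_exp_mul_I_mem_slitPlane (abs_lt.2 hy))).comp y hl
      have hl2 : HasDerivAt (fun y : ℝ => (-(s * y * Complex.I) : ℂ)) (-(s * Complex.I)) y := by
        have := hl.const_mul (-(s : ℂ))
        simpa only [neg_mul, mul_assoc] using this
      have h2 := h1.mul hl2.cexp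
      refine h2.congr_deriv ?_
      rw [hexp, Function.comp, onePlusExpPow_add_one hb]
      ring)
    ((((c2.const_mul _).sub (c1.const_mul _)).const_mul _).intervalIntegrable _ _)
  have hz : ∀ y : ℝ, Complex.exp (y * Complex.I) = -1 →
      onePlusExpPow (b + 1) (y * Complex.I) = 0 := by
    intro y hy
    rw [onePlusExpPow, hy, add_neg_cancel, Complex.zero_cpow]
    exact_mod_cast (by linarith : b + 1 ≠ 0)
  rw [hz π Complex.exp_pi_mul_I, hz (-π) (by
    rw [Complex.ofReal_neg, neg_mul, Complex.exp_neg, Complex.exp_pi_mul_I]; norm_num),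
    zero_mul, zero_mul, sub_zero, intervalIntegral.integral_const_mul,
    intervalIntegral.integral_sub ((c2.const_mul _).intervalIntegrable _ _)
      ((c1.const_mul _).intervalIntegrable _ _), intervalIntegral.integral_const_mul,
    intervalIntegral.integral_const_mul] at hi
  have := (mul_eq_zero.1 hi).resolve_left Complex.I_ne_zero
  exact (sub_eq_zero.1 this).symm

theorem tendsto_exp_mul_comap_re {c : ℝ} (hc : 0 < c) :
    Filter.Tendsto (fun w : ℂ => Complex.exp (c * w)) (Filter.comap Complex.re Filter.atBot)
      (nhds 0) := by
  refine Complex.tendsto_exp_comap_re_atBot.comp (Filter.tendsto_comap_iff.2 ?_)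
  have : Filter.Tendsto (fun w : ℂ => c * w.re) (Filter.comap Complex.re Filter.atBot)
      Filter.atBot := Filter.tendsto_comap.const_mul_atBot hc
  refine this.congr fun w => ?_
  simp

/-- For negative frequency the Fourier integral is a Beta integral. -/
theorem fourierOnePlus_of_neg {b s : ℝ} (hb : 0 < b) (hs : s < 0) :
    fourierOnePlus b s = -2 * Real.sin (s * π) * Complex.betaIntegral (-s) (b + 1) := by
  have hconv := Complex.betaIntegral_convergent (u := -(s : ℂ)) (v := (b : ℂ) + 1)
    (by simpa using hs) (by simp; linarith)
  have h := integral_halfStrip_side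
    (f := fun w => onePlusExpPow b w * Complex.exp ((-s : ℝ) * w))
    -- On the edges e^{-sw} differs by e^{-sx}(e^{-isπ} - e^{isπ}), and e^{-sx} = t · t^{-s-1} for t
    -- = e^x.
    (g := fun t => -2 * Complex.I * Real.sin (s * π) *
      ((t : ℂ) ^ (-(s : ℂ) - 1) * (1 - (t : ℂ)) ^ ((b : ℂ) + 1 - 1)))
    (fun w hw => ((continuousAt_onePlusExpPow hb hw.1).mul (by fun_prop)).continuousWithinAt)
    (fun w hw => ((differentiableAt_onePlusExpPow b hw.1).mul
      (by fun_prop)).differentiableWithinAt)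
    (by simpa using (tendsto_onePlusExpPow b).mul (tendsto_exp_mul_comap_re (neg_pos.2 hs)))
    (by
      intro t ht
      apply ContinuousAt.continuousWithinAt
      refine continuousAt_const.mul (ContinuousAt.mul ?_ ?_)
      · exact ContinuousAt.cpow (by fun_prop) continuousAt_const (by left; simpa using ht.1)
      · have := Complex.continuousAt_cpow_const_of_re_pos (z := 1 - (t : ℂ))
          (w := (b : ℂ) + 1 - 1) (Or.inl (by simpa using ht.2)) (by simpa using hb)
        exact ContinuousAt.comp (f := fun t : ℝ => 1 - (t : ℂ)) this (by fun_prop))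
    (hconv.const_mul _)
    (by
      intro x hx
      have hex : 0 ≤ 1 - Real.exp x := sub_nonneg.2 (Real.exp_le_one_iff.2 hx)
      rw [onePlusExpPow_add_pi b hx, onePlusExpPow_sub_pi b hx, add_sub_cancel_right,
        Complex.ofReal_cpow hex]
      have e1 : ((Real.exp x : ℝ) : ℂ) ^ (-(s : ℂ) - 1) =
          Complex.exp (-s * x) / Complex.exp x := by
        rw [Complex.ofReal_exp, Complex.cpow_def_of_ne_zero (Complex.exp_ne_zero _),
          Complex.log_exp (by simp [Real.pi_pos]) (by simp [Real.pi_pos.le]), ← Complex.exp_sub]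
        congr 1
        ring
      rw [e1, Complex.ofReal_exp]
      have e2 : Complex.exp ((-s : ℝ) * (x + π * Complex.I)) =
          Complex.exp (-s * x) * Complex.exp (-(s * π * Complex.I)) := by
        rw [← Complex.exp_add]; congr 1; push_cast; ring
      have e3 : Complex.exp ((-s : ℝ) * (x - π * Complex.I)) =
          Complex.exp (-s * x) * Complex.exp ((s * π) * Complex.I) := by
        rw [← Complex.exp_add]; congr 1; push_cast; ring
      have e4 : (Real.sin (s * π) : ℂ) * 2 * Complex.I = Complex.exp ((s * π) * Complex.I) -
          Complex.exp (-(s * π * Complex.I)) := by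
        push_cast
        rw [Complex.sin, neg_mul]
        linear_combination (Complex.exp (-(s * π * Complex.I)) -
          Complex.exp ((s * π) * Complex.I)) * Complex.I_mul_I
      rw [e2, e3]
      have hne := Complex.exp_ne_zero (x : ℂ)
      push_cast at e4 ⊢
      field_simp
      linear_combination ((1 - Complex.exp x) ^ (b : ℂ)) * e4)
  rw [intervalIntegral.integral_const_mul] at h
  rw [fourierOnePlus, Complex.betaIntegral]
  have e : ∀ y : ℝ, Complex.exp (-(s * y * Complex.I)) =
      Complex.exp ((-s : ℝ) * (y * Complex.I)) := by
    intro y; congr 1; push_cast; ring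
  simp only [e]
  rw [h]
  linear_combination (2 * (Real.sin (s * π) : ℂ) * ∫ x in (0 : ℝ)..1,
    (x : ℂ) ^ (-(s : ℂ) - 1) * (1 - (x : ℂ)) ^ ((b : ℂ) + 1 - 1)) * Complex.I_mul_I

/-- The functional equation of Γ gives the recurrence of `mul_fourierOnePlus`; s ≤ b keeps Γ(b - s +
1) away from its poles. -/
theorem mul_gammaChoose {b s : ℝ} (hs0 : s ≠ 0) (hsb : s ≤ b) :
    s * gammaChoose b s = (b + 1 - s) * gammaChoose b (s - 1) := by
  have h1 : b - s + 1 ≠ 0 := by linarith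
  unfold gammaChoose
  rw [Real.Gamma_add_one hs0, sub_add_cancel, show b - (s - 1) + 1 = (b - s + 1) + 1 by ring,
    Real.Gamma_add_one h1]
  have h2 : Real.Gamma (b - s + 1) ≠ 0 := (Real.Gamma_pos_of_pos (by linarith)).ne'
  by_cases h3 : Real.Gamma s = 0
  · simp [h3]
  · field_simp
    ring

/-- The generalised binomial coefficients are Fourier coefficients of `(1 + e^{iy}) ^ b`. -/
theorem fourierOnePlus_eq_gammaChoose {b s : ℝ} (hb : 0 < b) (hs : s ≤ b) :
    fourierOnePlus b s = 2 * π * gammaChoose b s := by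
  have hpi := Real.pi_pos
  have hneg : ∀ s : ℝ, s < 0 → fourierOnePlus b s = 2 * π * gammaChoose b s := by
    intro s hs
    rw [fourierOnePlus_of_neg hb hs]
    have hB := Complex.Gamma_mul_Gamma_eq_betaIntegral (s := -(s : ℂ)) (t := (b : ℂ) + 1)
      (by simpa using hs) (by simp; linarith)
    have hr := Real.Gamma_mul_Gamma_one_sub (-s)
    have hg : Real.Gamma (-s) ≠ 0 := (Real.Gamma_pos_of_pos (by linarith)).ne'
    have hg2 : Real.Gamma (b - s + 1) ≠ 0 := (Real.Gamma_pos_of_pos (by linarith)).ne'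
    have hB' : Complex.betaIntegral (-s) (b + 1) =
        ((Real.Gamma (-s) * Real.Gamma (b + 1) / Real.Gamma (b - s + 1) : ℝ) : ℂ) := by
      have e : -(s : ℂ) + (b + 1) = ((b - s + 1 : ℝ) : ℂ) := by push_cast; ring
      have e2 : -(s : ℂ) = ((-s : ℝ) : ℂ) := by push_cast; ring
      have e3 : (b : ℂ) + 1 = ((b + 1 : ℝ) : ℂ) := by push_cast; ring
      rw [e, e2, e3, Complex.Gamma_ofReal, Complex.Gamma_ofReal, Complex.Gamma_ofReal] at hB
      rw [e2, e3]
      push_cast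
      have hg2' : (Real.Gamma (b - s + 1) : ℂ) ≠ 0 := by exact_mod_cast hg2
      push_cast at hB
      rw [hB, mul_div_cancel_left₀ _ (by exact_mod_cast hg2')]
    rw [hB']
    unfold gammaChoose
    rw [show 1 - -s = s + 1 by ring, show π * -s = -(s * π) by ring, Real.sin_neg] at hr
    norm_cast
    -- Here s is a negative integer. The reflection formula, read with x / 0 = 0, yields Γ(s + 1) =
    -- 0, so both sides vanish.
    by_cases hsin : Real.sin (s * π) = 0
    · rw [hsin, neg_zero, div_zero] at hr
      have := (mul_eq_zero.1 hr).resolve_left hg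
      rw [hsin, this]
      simp
    · have hne : Real.Gamma (s + 1) ≠ 0 := by
        intro h
        rw [h, mul_zero] at hr
        exact (div_ne_zero hpi.ne' (neg_ne_zero.2 hsin)) hr.symm
      have h5 : Real.sin (s * π) * (Real.Gamma (-s) * Real.Gamma (s + 1)) = -π := by
        rw [hr]; field_simp
      push_cast
      field_simp
      linear_combination -h5
  -- The recurrence multiplies by s and says nothing about s = 0; this value is the limit from the
  -- negative side.
  have hzero : fourierOnePlus b 0 = 2 * π * gammaChoose b 0 := by
    have h1 : Filter.Tendsto (fourierOnePlus b) (nhdsWithin 0 (Set.Iio 0))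
        (nhds (fourierOnePlus b 0)) :=
      ((continuous_fourierOnePlus hb).tendsto 0).mono_left nhdsWithin_le_nhds
    have hc : ContinuousAt (gammaChoose b) 0 := by
      unfold gammaChoose
      have c1 : ContinuousAt Real.Gamma (0 + 1) :=
        Real.differentiableOn_Gamma_Ioi.continuousOn.continuousAt (Ioi_mem_nhds (by norm_num))
      have c2 : ContinuousAt Real.Gamma (b - 0 + 1) :=
        Real.differentiableOn_Gamma_Ioi.continuousOn.continuousAt (Ioi_mem_nhds (by linarith))
      refine continuousAt_const.div (ContinuousAt.mul ?_ ?_) ?_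
      · exact ContinuousAt.comp (f := fun x : ℝ => x + 1) c1 (by fun_prop)
      · exact ContinuousAt.comp (f := fun x : ℝ => b - x + 1) c2 (by fun_prop)
      · exact (mul_pos (Real.Gamma_pos_of_pos (by norm_num))
          (Real.Gamma_pos_of_pos (by linarith))).ne'
    have h2 : Filter.Tendsto (fun s => 2 * (π : ℂ) * gammaChoose b s)
        (nhdsWithin 0 (Set.Iio 0)) (nhds (2 * π * gammaChoose b 0)) :=
      (((Complex.continuous_ofReal.tendsto _).comp hc.tendsto).const_mul _).mono_left
        nhdsWithin_le_nhds
    refine tendsto_nhds_unique h1 (h2.congr' ?_)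
    filter_upwards [self_mem_nhdsWithin] with s hs using (hneg s hs).symm
  have hind : ∀ N : ℕ, ∀ s : ℝ, s < N → s ≤ b → fourierOnePlus b s = 2 * π * gammaChoose b s := by
    intro N
    induction N with
    | zero => intro s hs _; exact hneg s (by simpa using hs)
    | succ N ih =>
      intro s hsN hsb
      rcases eq_or_ne s 0 with rfl | hs0
      · exact hzero
      · have h1 := ih (s - 1) (by push_cast at hsN; linarith) (by linarith)
        have h2 := mul_fourierOnePlus hb s
        have h3 := congrArg (fun x : ℝ => (x : ℂ)) (mul_gammaChoose hs0 hsb)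
        push_cast at h3
        rw [h1] at h2
        have hs0' : (s : ℂ) ≠ 0 := by exact_mod_cast hs0
        apply mul_left_cancel₀ hs0'
        linear_combination h2 - 2 * π * h3
  obtain ⟨N, hN⟩ := exists_nat_gt s
  exact hind N s hN hs

/-! ### The density on the slit -/

/-- The jump across the cut, as a density on the unit interval. -/
noncomputable def cutDensity (α b μ t : ℝ) : ℝ :=
  t ^ (α - 1) * ((1 - t) ^ b /
    ‖((t ^ α : ℝ) : ℂ) - ((μ ^ α : ℝ) : ℂ) * Complex.exp (-(Complex.I * α * π))‖ ^ 2)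

theorem exp_neg_I_mul_eq (α : ℝ) : Complex.exp (-(Complex.I * α * π)) =
    Real.cos (α * π) - Real.sin (α * π) * Complex.I := by
  rw [show -(Complex.I * α * π) = -((α * π : ℝ) : ℂ) * Complex.I by push_cast; ring,
    Complex.exp_mul_I, Complex.cos_neg, Complex.sin_neg, ← Complex.ofReal_cos,
    ← Complex.ofReal_sin]
  ring

theorem norm_sub_mul_exp_sq (α x y : ℝ) :
    ‖(x : ℂ) - (y : ℂ) * Complex.exp (-(Complex.I * α * π))‖ ^ 2
      = x ^ 2 + y ^ 2 - 2 * x * y * Real.cos (α * π) := by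
  rw [exp_neg_I_mul_eq, ← Complex.normSq_eq_norm_sq, Complex.normSq_apply]
  simp only [Complex.sub_re, Complex.sub_im, Complex.mul_re, Complex.mul_im, Complex.ofReal_re,
    Complex.ofReal_im, Complex.I_re, Complex.I_im]
  have := Real.sin_sq_add_cos_sq (α * π)
  linear_combination y ^ 2 * this

/-- With κ = cos(απ), the right side is x² + y² - 2κxy. If κ ≤ 0 the cross term only helps;
otherwise the expression equals (1 - κ)(x² + y²) + κ(x - y)². -/
theorem exists_le_norm_sub_mul_exp_sq {α : ℝ} (hα : Real.cos (α * π) ≠ 1) :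
    ∃ c > 0, ∀ x y : ℝ, 0 ≤ x → 0 ≤ y →
      c * (x ^ 2 + y ^ 2) ≤ ‖(x : ℂ) - (y : ℂ) * Complex.exp (-(Complex.I * α * π))‖ ^ 2 := by
  have h1 : Real.cos (α * π) < 1 := lt_of_le_of_ne (Real.cos_le_one _) hα
  refine ⟨min 1 (1 - Real.cos (α * π)), lt_min one_pos (by linarith), fun x y hx hy => ?_⟩
  rw [norm_sub_mul_exp_sq]
  have hxy := mul_nonneg hx hy
  rcases le_total (Real.cos (α * π)) 0 with h | h
  · have := mul_le_mul_of_nonneg_right (min_le_left 1 (1 - Real.cos (α * π)))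
      (by positivity : 0 ≤ x ^ 2 + y ^ 2)
    nlinarith [mul_nonneg hxy (neg_nonneg.2 h)]
  · have := mul_le_mul_of_nonneg_right (min_le_right 1 (1 - Real.cos (α * π)))
      (by positivity : 0 ≤ x ^ 2 + y ^ 2)
    nlinarith [mul_nonneg h (sq_nonneg (x - y))]

theorem norm_sub_mul_exp_sq_pos {α x y : ℝ} (hα : Real.cos (α * π) ≠ 1) (hx : 0 ≤ x) (hy : 0 < y) :
    0 < ‖(x : ℂ) - (y : ℂ) * Complex.exp (-(Complex.I * α * π))‖ ^ 2 := by
  obtain ⟨c, hc, h⟩ := exists_le_norm_sub_mul_exp_sq hα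
  exact lt_of_lt_of_le (by positivity) (h x y hx hy.le)

theorem continuousOn_cutDensity_factor {α b μ : ℝ} (hα : 0 < α) (hb : 0 ≤ b) (hμ : 0 < μ)
    (hcos : Real.cos (α * π) ≠ 1) : ContinuousOn (fun t : ℝ => (1 - t) ^ b /
    ‖((t ^ α : ℝ) : ℂ) - ((μ ^ α : ℝ) : ℂ) * Complex.exp (-(Complex.I * α * π))‖ ^ 2)
    (Set.Icc 0 1) := by
  refine ContinuousOn.div ?_ ?_ ?_
  · exact (Continuous.rpow_const (by fun_prop) fun _ => Or.inr hb).continuousOn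
  · have : Continuous fun t : ℝ => t ^ α := Real.continuous_rpow_const hα.le
    fun_prop
  · intro t ht
    exact (norm_sub_mul_exp_sq_pos hcos (Real.rpow_nonneg ht.1 _) (Real.rpow_pos_of_pos hμ _)).ne'

theorem intervalIntegrable_cutDensity {α b μ : ℝ} (hα : 0 < α) (hb : 0 ≤ b) (hμ : 0 < μ)
    (hcos : Real.cos (α * π) ≠ 1) : IntervalIntegrable (cutDensity α b μ) volume 0 1 := by
  refine (intervalIntegral.intervalIntegrable_rpow' (by linarith : -1 < α - 1)).mul_continuousOn ?_
  rw [Set.uIcc_of_le zero_le_one]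
  exact continuousOn_cutDensity_factor hα hb hμ hcos

theorem continuousOn_cutDensity {α b μ : ℝ} (hα : 0 < α) (hb : 0 ≤ b) (hμ : 0 < μ)
    (hcos : Real.cos (α * π) ≠ 1) : ContinuousOn (cutDensity α b μ) (Set.Ioc 0 1) := by
  refine ContinuousOn.mul ?_
    ((continuousOn_cutDensity_factor hα hb hμ hcos).mono Set.Ioc_subset_Icc_self)
  exact fun t ht => (Real.continuousAt_rpow_const t _ (Or.inl ht.1.ne')).continuousWithinAt

theorem cutDensity_nonneg {α b μ t : ℝ} (h0 : 0 ≤ t) (h1 : t ≤ 1) : 0 ≤ cutDensity α b μ t :=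
  mul_nonneg (Real.rpow_nonneg h0 _)
    (div_nonneg (Real.rpow_nonneg (sub_nonneg.2 h1) _) (sq_nonneg _))

/-- Dominated convergence: for parameters above μ/2 the denominator is at least c (μ/2)^{2α}. This
serves the passage to λ = 1. -/
theorem continuousAt_integral_cutDensity {α b μ : ℝ} (hα : 0 < α) (hb : 0 ≤ b) (hμ : 0 < μ)
    (hcos : Real.cos (α * π) ≠ 1) :
    ContinuousAt (fun μ => ∫ t in (0 : ℝ)..1, cutDensity α b μ t) μ := by
  obtain ⟨c, hc, hle⟩ := exists_le_norm_sub_mul_exp_sq hcos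
  have hpos : ∀ᶠ ν in nhds μ, μ / 2 < ν := lt_mem_nhds (by linarith)
  refine intervalIntegral.continuousAt_of_dominated_interval
    (bound := fun t => t ^ (α - 1) * (c * ((μ / 2) ^ α) ^ 2)⁻¹) ?_ ?_
    ((intervalIntegral.intervalIntegrable_rpow' (by linarith : -1 < α - 1)).mul_const _) ?_
  · filter_upwards [hpos] with ν hν
    have := intervalIntegrable_cutDensity hα hb (by linarith : 0 < ν) hcos
    rw [Set.uIoc_of_le zero_le_one]
    exact this.aestronglyMeasurable
  · filter_upwards [hpos] with ν hν
    refine Filter.Eventually.of_forall fun t ht => ?_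
    rw [Set.uIoc_of_le zero_le_one] at ht
    rw [Real.norm_of_nonneg (cutDensity_nonneg ht.1.le ht.2)]
    refine mul_le_mul_of_nonneg_left ?_ (Real.rpow_nonneg ht.1.le _)
    rw [← one_div]
    refine div_le_div₀ zero_le_one (Real.rpow_le_one (by linarith [ht.2]) (by linarith [ht.1]) hb)
      (by positivity) ?_
    refine le_trans ?_ (hle _ _ (Real.rpow_nonneg ht.1.le _)
      (Real.rpow_nonneg (by linarith : 0 ≤ ν) _))
    refine mul_le_mul_of_nonneg_left ?_ hc.le
    have h1 : (μ / 2) ^ α ≤ ν ^ α := Real.rpow_le_rpow (by linarith) hν.le hα.le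
    have h2 : 0 ≤ (μ / 2) ^ α := by positivity
    nlinarith [sq_nonneg (t ^ α)]
  · refine Filter.Eventually.of_forall fun t ht => ?_
    rw [Set.uIoc_of_le zero_le_one] at ht
    refine continuousAt_const.mul (continuousAt_const.div ?_ ?_)
    · have : ContinuousAt (fun ν : ℝ => ν ^ α) μ :=
        Real.continuousAt_rpow_const μ _ (Or.inl hμ.ne')
      fun_prop
    · exact (norm_sub_mul_exp_sq_pos hcos (Real.rpow_nonneg ht.1.le _)
        (Real.rpow_pos_of_pos hμ _)).ne'

/-! ### Deformation of the circle to the slit -/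

/-- The integral over the unit circle, slit at `-1`, of `(1 + z) ^ b` against
`α z^α / (z^α - μ^α)`. -/
noncomputable def circleKernelIntegral (α b μ : ℝ) : ℂ :=
  ∫ y in (-π)..π, onePlusExpPow b (y * Complex.I) * (α * Complex.exp (α * (y * Complex.I)) /
    (Complex.exp (α * (y * Complex.I)) - (μ ^ α : ℝ)))

/-- Deforming the slit unit circle to the slit. -/
theorem circleKernelIntegral_eq {α b μ : ℝ} (hα : 0 < α) (hb : 0 < b) (hμ : 0 < μ)
    (hcos : Real.cos (α * π) ≠ 1) (S : Finset ℂ)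
    (hS : ∀ s ∈ S, s ∈ openHalfStrip ∧ Complex.exp (α * s) = (μ ^ α : ℝ))
    (hS' : ∀ w ∈ closedHalfStrip, Complex.exp (α * w) = (μ ^ α : ℝ) → w ∈ S) :
    circleKernelIntegral α b μ = 2 * π * ∑ s ∈ S, onePlusExpPow b s -
      ((2 * α * μ ^ α * Real.sin (α * π) * ∫ t in (0 : ℝ)..1, cutDensity α b μ t : ℝ) : ℂ) := by
  have hαc : (α : ℂ) ≠ 0 := by exact_mod_cast hα.ne'
  have hm : 0 < μ ^ α := Real.rpow_pos_of_pos hμ _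
  have hne : ∀ w ∈ closedHalfStrip, w ∉ (S : Set ℂ) →
      Complex.exp (α * w) - (μ ^ α : ℝ) ≠ 0 :=
    fun w hw hwS h => hwS (by simpa using hS' w hw (sub_eq_zero.1 h))
  have hcutc : ContinuousOn (fun t => ((cutDensity α b μ t : ℝ) : ℂ)) (Set.Ioc 0 1) :=
    Complex.continuous_ofReal.comp_continuousOn (continuousOn_cutDensity hα hb.le hμ hcos)
  have hcuti : IntervalIntegrable (fun t => ((cutDensity α b μ t : ℝ) : ℂ)) volume 0 1 :=
    ⟨(intervalIntegrable_cutDensity hα hb.le hμ hcos).1.ofReal,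
      (intervalIntegrable_cutDensity hα hb.le hμ hcos).2.ofReal⟩
  have h := integral_halfStrip_side_eq_residues
    (f := fun w => onePlusExpPow b w * (α * Complex.exp (α * w) /
      (Complex.exp (α * w) - (μ ^ α : ℝ))))
    -- With E = e^{αx}, u = e^{iαπ}, ū = e^{-iαπ} and m = μ^α, the jump Eu/(Eu - m) - Eū/(Eū - m)
    -- equals -mE(u - ū) / |E - mū|², and u - ū = 2i sin(απ).
    (g := fun t => -2 * Complex.I * α * (μ ^ α : ℝ) * Real.sin (α * π) * (cutDensity α b μ t : ℝ))
    S (onePlusExpPow b) (fun s hs => (hS s hs).1)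
    (by
      intro w hw
      refine ((continuousAt_onePlusExpPow hb hw.1.1).mul
        (ContinuousAt.div (by fun_prop) (by fun_prop) (hne w hw.1 hw.2))).continuousWithinAt)
    (by
      intro w hw
      refine ((differentiableAt_onePlusExpPow b hw.1.1).mul (DifferentiableAt.div (by fun_prop)
        (by fun_prop) (hne w (openHalfStrip_subset_closedHalfStrip hw.1) hw.2))).differentiableWithinAt)
    (by
      intro s hs
      have h1 := tendsto_mul_exp_div_exp_sub hαc s
      rw [(hS s hs).2] at h1
      have h2 : Filter.Tendsto (onePlusExpPow b) (nhdsWithin s {s}ᶜ) (nhds (onePlusExpPow b s)) :=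
        (continuousAt_onePlusExpPow hb (hS s hs).1.1.le).tendsto.mono_left nhdsWithin_le_nhds
      have h3 := h2.mul h1
      rw [mul_one] at h3
      refine h3.congr fun w => ?_
      ring)
    (by
      have h1 := tendsto_exp_mul_comap_re hα
      have h2 := (h1.const_mul (α : ℂ)).div (h1.sub_const ((μ ^ α : ℝ) : ℂ))
        (by rw [zero_sub, neg_ne_zero]; exact_mod_cast hm.ne')
      have h3 := (tendsto_onePlusExpPow b).mul h2
      simpa using h3)
    (hcutc.const_mul _) (hcuti.const_mul _)
    (by
      intro x hx
      have hex : (Real.exp x) ^ α = Real.exp (α * x) := by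
        rw [← Real.exp_mul, mul_comm]
      have hex1 : Real.exp x * (Real.exp x) ^ (α - 1) = Real.exp (α * x) := by
        rw [← hex, Real.rpow_sub_one (Real.exp_pos x).ne', mul_div_cancel₀ _ (Real.exp_pos x).ne']
      rw [onePlusExpPow_add_pi b hx, onePlusExpPow_sub_pi b hx]
      have e1 : Complex.exp (α * (x + π * Complex.I)) = Real.exp (α * x) *
          (Real.cos (α * π) + Real.sin (α * π) * Complex.I) := by
        rw [mul_add, Complex.exp_add, ← mul_assoc, ← Complex.ofReal_mul α π, Complex.exp_mul_I]
        push_cast; rfl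
      have e2 : Complex.exp (α * (x - π * Complex.I)) = Real.exp (α * x) *
          (Real.cos (α * π) - Real.sin (α * π) * Complex.I) := by
        rw [← exp_neg_I_mul_eq, Complex.ofReal_exp, ← Complex.exp_add]
        congr 1; push_cast; ring
      have hN : (‖((Real.exp (α * x) : ℝ) : ℂ) -
          ((μ ^ α : ℝ) : ℂ) * Complex.exp (-(Complex.I * α * π))‖ ^ 2 : ℝ) =
          Real.exp (α * x) ^ 2 + (μ ^ α) ^ 2 -
            2 * Real.exp (α * x) * μ ^ α * Real.cos (α * π) := norm_sub_mul_exp_sq _ _ _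
      have hd1 := hne (x + π * Complex.I) ⟨by simpa using hx, by simp [abs_of_pos Real.pi_pos]⟩
        (fun h => ((hS _ h).1.2).ne (by simp [abs_of_pos Real.pi_pos]))
      have hd2 := hne (x - π * Complex.I) ⟨by simpa using hx, by simp [abs_of_pos Real.pi_pos]⟩
        (fun h => ((hS _ h).1.2).ne (by simp [abs_of_pos Real.pi_pos]))
      rw [e1] at hd1 ⊢
      rw [e2] at hd2 ⊢
      have hg : ((Real.exp x : ℝ) : ℂ) * (cutDensity α b μ (Real.exp x) : ℝ) =
          Real.exp (α * x) * ((1 - Real.exp x) ^ b : ℝ) / ((Real.exp (α * x) : ℂ) ^ 2 +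
            ((μ ^ α : ℝ) : ℂ) ^ 2 - 2 * Real.exp (α * x) * (μ ^ α : ℝ) * Real.cos (α * π)) := by
        rw [cutDensity, hex, hN, ← Complex.ofReal_mul, ← mul_assoc, hex1]
        push_cast
        ring
      have hsc : (Real.sin (α * π) : ℂ) ^ 2 + (Real.cos (α * π) : ℂ) ^ 2 = 1 := by
        exact_mod_cast Real.sin_sq_add_cos_sq (α * π)
      rw [mul_left_comm ((Real.exp x : ℝ) : ℂ), hg]
      -- The kernel's denominators on the two edges are complex conjugates, so their product is the
      -- squared norm in the density.
      have hprod : (((Real.exp (α * x) : ℝ) : ℂ) ^ 2 +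
            ((μ ^ α : ℝ) : ℂ) ^ 2 - 2 * Real.exp (α * x) * (μ ^ α : ℝ) * Real.cos (α * π)) =
          (Real.exp (α * x) * (Real.cos (α * π) + Real.sin (α * π) * Complex.I) - (μ ^ α : ℝ)) *
          (Real.exp (α * x) * (Real.cos (α * π) - Real.sin (α * π) * Complex.I) - (μ ^ α : ℝ)) := by
        linear_combination (-((Real.exp (α * x) : ℝ) : ℂ) ^ 2) * hsc +
          ((Real.exp (α * x) : ℝ) : ℂ) ^ 2 * (Real.sin (α * π) : ℂ) ^ 2 * Complex.I_mul_I
      rw [hprod]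
      field_simp
      ring)
  rw [circleKernelIntegral, h, intervalIntegral.integral_const_mul,
    intervalIntegral.integral_ofReal]
  push_cast
  linear_combination (2 * α * ((μ ^ α : ℝ) : ℂ) * Complex.sin (α * π) *
    ((∫ t in (0 : ℝ)..1, cutDensity α b μ t : ℝ) : ℂ)) * Complex.I_mul_I

/-! ### From the binomial sum to two contour integrals -/

/-- The reflection `(1 + z) ^ b = z ^ b (1 + z⁻¹) ^ b` on the unit circle. -/
theorem onePlusExpPow_mul_exp_neg (b : ℝ) {y : ℝ} (hy : |y| < π) :
    onePlusExpPow b (y * Complex.I) * Complex.exp (-(b * (y * Complex.I))) =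
      onePlusExpPow b (((-y : ℝ) : ℂ) * Complex.I) := by
  -- Polar form 1 + e^{ix} = 2 cos(x/2) e^{ix/2}: the modulus is even in x and the argument odd.
  have key : ∀ x : ℝ, |x| < π → onePlusExpPow b (x * Complex.I) =
      Complex.exp (b * (Real.log (2 * Real.cos (x / 2)) + x / 2 * Complex.I)) := by
    intro x hx
    have h := abs_lt.1 hx
    have h0 : 0 < 2 * Real.cos (x / 2) :=
      mul_pos two_pos (Real.cos_pos_of_mem_Ioo ⟨by linarith, by linarith⟩)
    have e : 1 + Complex.exp (x * Complex.I) =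
        (2 * Real.cos (x / 2) : ℝ) * Complex.exp (x / 2 * Complex.I) := by
      push_cast
      rw [Complex.cos, mul_div_cancel₀ _ two_ne_zero, add_mul, ← Complex.exp_add,
        ← Complex.exp_add]
      rw [show (x : ℂ) / 2 * Complex.I + x / 2 * Complex.I = x * Complex.I by ring,
        show -((x : ℂ) / 2) * Complex.I + x / 2 * Complex.I = 0 by ring, Complex.exp_zero, add_comm]
    have hne : (1 : ℂ) + Complex.exp (x * Complex.I) ≠ 0 :=
      Complex.slitPlane_ne_zero (one_add_exp_mul_I_mem_slitPlane hx)
    have him : ((x : ℂ) / 2 * Complex.I).im = x / 2 := by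
      rw [show (x : ℂ) / 2 * Complex.I = ((x / 2 : ℝ) : ℂ) * Complex.I by push_cast; ring]
      simp
    rw [onePlusExpPow, Complex.cpow_def_of_ne_zero hne, e,
      Complex.log_ofReal_mul h0 (Complex.exp_ne_zero _),
      Complex.log_exp (by rw [him]; linarith) (by rw [him]; linarith), mul_comm]
  rw [key y hy, key (-y) (by rwa [abs_neg]), ← Complex.exp_add, neg_div, Real.cos_neg]
  congr 1
  push_cast
  ring

/-- The fractional binomial sum as a pair of contour integrals. -/
theorem fracBinomSum_eq_circleKernelIntegral {α : ℝ} (hα : 0 < α) {n : ℕ} (hn : 1 ≤ n) {l : ℝ}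
    (hl0 : 0 < l) (hl1 : l < 1) :
    2 * π * (fracBinomSum α n l : ℂ) = circleKernelIntegral α (α * n) l +
      ((l ^ (α * n) : ℝ) : ℂ) * circleKernelIntegral α (α * n) l⁻¹ := by
  have hpi := Real.pi_pos
  have hn' : (1 : ℝ) ≤ n := by exact_mod_cast hn
  have hb : 0 < α * n := by positivity
  have hF := continuous_onePlusExpPow_mul_I hb
  have hm0 : 0 < l ^ α := Real.rpow_pos_of_pos hl0 _
  have hm1 : l ^ α < 1 := Real.rpow_lt_one hl0.le hl1 hα
  have hunit : ∀ y : ℝ, ‖Complex.exp (α * (y * Complex.I))‖ = 1 := by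
    intro y
    rw [← mul_assoc, ← Complex.ofReal_mul, Complex.norm_exp_ofReal_mul_I]
  have hden : ∀ m : ℝ, 0 < m → m ≠ 1 → ∀ y : ℝ,
      Complex.exp (α * (y * Complex.I)) - (m : ℝ) ≠ 0 := by
    intro m hm hm1 y h
    have := congrArg norm (sub_eq_zero.1 h)
    rw [hunit, Complex.norm_real, Real.norm_of_nonneg hm.le] at this
    exact hm1 this.symm
  have hinv : (l⁻¹) ^ α = (l ^ α)⁻¹ := Real.inv_rpow hl0.le _
  have hinv1 : (l ^ α)⁻¹ ≠ 1 := fun h => hm1.ne (inv_eq_one.1 h)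
  set K : ℝ → ℝ → ℂ := fun m y => onePlusExpPow (α * n) (y * Complex.I) *
    (α * Complex.exp (α * (y * Complex.I)) / (Complex.exp (α * (y * Complex.I)) - (m : ℝ))) with hK
  have hKc : ∀ m : ℝ, 0 < m → m ≠ 1 → Continuous (K m) := fun m hm hm1 =>
    hF.mul (Continuous.div (by fun_prop) (by fun_prop) (hden m hm hm1))
  have hterm : ∀ j ∈ Finset.range (n + 1),
      2 * π * ((gammaChoose (α * n) (α * j) * l ^ (α * j) : ℝ) : ℂ) =
        ∫ y in (-π)..π, onePlusExpPow (α * n) (y * Complex.I) *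
          (((l ^ α : ℝ) : ℂ) * Complex.exp (-(α * (y * Complex.I)))) ^ j := by
    intro j hj
    have hjn : (j : ℝ) ≤ n := by exact_mod_cast Nat.lt_succ_iff.1 (Finset.mem_range.1 hj)
    have h := fourierOnePlus_eq_gammaChoose hb (mul_le_mul_of_nonneg_left hjn hα.le)
    push_cast at h ⊢
    rw [← mul_assoc, ← h, fourierOnePlus, ← intervalIntegral.integral_mul_const]
    refine intervalIntegral.integral_congr fun y _ => ?_
    have e1 : ((l ^ (α * j) : ℝ) : ℂ) = ((l ^ α : ℝ) : ℂ) ^ j := by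
      rw [Real.rpow_mul_natCast hl0.le]; push_cast; rfl
    rw [mul_pow, ← e1, ← Complex.exp_nat_mul, mul_assoc, mul_comm (Complex.exp _)]
    congr 3
    push_cast
    ring
  have hci : ∀ j ∈ Finset.range (n + 1), IntervalIntegrable (fun y : ℝ =>
      onePlusExpPow (α * n) (y * Complex.I) *
          (((l ^ α : ℝ) : ℂ) * Complex.exp (-(α * (y * Complex.I)))) ^ j) volume (-π) π :=
    fun j _ => (hF.mul (by fun_prop)).intervalIntegrable _ _
  -- With q = m/E, m = λ^α and E = e^{iαy}, the series is 1/(1 - q) + q^n/(1 - 1/q). The first part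
  -- is E/(E - m). In the second, E^{-n} is absorbed by the reflection, leaving the kernel for 1/m
  -- at -y.
  have hsum : 2 * π * (fracBinomSum α n l : ℂ) = ∫ y in (-π)..π,
      (K (l ^ α) y + ((l ^ (α * n) : ℝ) : ℂ) * K ((l ^ α)⁻¹) (-y)) := by
    have h1 : 2 * π * (fracBinomSum α n l : ℂ) = α * ∑ j ∈ Finset.range (n + 1),
        2 * π * ((gammaChoose (α * n) (α * j) * l ^ (α * j) : ℝ) : ℂ) := by
      rw [fracBinomSum, ← Finset.mul_sum]
      push_cast
      ring
    rw [h1, Finset.sum_congr rfl hterm, ← intervalIntegral.integral_finsetSum hci,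
      ← intervalIntegral.integral_const_mul]
    -- The reflection is available only for |y| < π, so the endpoints are discarded.
    refine intervalIntegral.integral_congr_Ioo_of_le (by linarith) fun y hy => ?_
    have hrefl := onePlusExpPow_mul_exp_neg (α * n) (abs_lt.2 hy)
    simp only [hK]
    rw [← hrefl, ← Finset.mul_sum]
    have hE0 := Complex.exp_ne_zero (α * (y * Complex.I))
    have hd1 := hden _ hm0 hm1.ne y
    have hd2 := hden _ (inv_pos.2 hm0) hinv1 (-y)
    have hexp2 : Complex.exp (α * (((-y : ℝ) : ℂ) * Complex.I)) =
        (Complex.exp (α * (y * Complex.I)))⁻¹ := by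
      rw [← Complex.exp_neg]; congr 1; push_cast; ring
    have hexp3 : Complex.exp (-(((α * n : ℝ) : ℂ) * (y * Complex.I))) =
        ((Complex.exp (α * (y * Complex.I)))⁻¹) ^ n := by
      rw [← Complex.exp_neg, ← Complex.exp_nat_mul]; congr 1; push_cast; ring
    have hln : ((l ^ (α * n) : ℝ) : ℂ) = ((l ^ α : ℝ) : ℂ) ^ n := by
      rw [Real.rpow_mul_natCast hl0.le]; push_cast; rfl
    rw [hexp2] at hd2 ⊢
    rw [hexp3, hln, Complex.exp_neg]
    rw [Complex.ofReal_inv] at hd2 ⊢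
    have hmc : ((l ^ α : ℝ) : ℂ) ≠ 0 := by exact_mod_cast hm0.ne'
    generalize Complex.exp (α * (y * Complex.I)) = E at *
    generalize ((l ^ α : ℝ) : ℂ) = m at *
    generalize onePlusExpPow (α * n) (y * Complex.I) = F at *
    have hq : m * E⁻¹ ≠ 1 := by
      intro h
      apply hd1
      field_simp at h
      rw [h, sub_self]
    rw [geom_sum_eq hq]
    have e1 : E⁻¹ - m⁻¹ = (m - E) / (E * m) := by field_simp
    have e2 : m * E⁻¹ - 1 = (m - E) / E := by field_simp
    have hd3 : m - E ≠ 0 := by rwa [← neg_sub, neg_ne_zero]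
    rw [e1, e2, pow_succ, mul_pow, show E - m = -(m - E) by ring]
    field_simp
    ring
  have hneg : Continuous fun y => ((l ^ (α * n) : ℝ) : ℂ) * K ((l ^ α)⁻¹) (-y) :=
    continuous_const.mul ((hKc _ (inv_pos.2 hm0) hinv1).comp continuous_neg)
  rw [hsum, intervalIntegral.integral_add ((hKc _ hm0 hm1.ne).intervalIntegrable _ _)
    (hneg.intervalIntegrable _ _),
    intervalIntegral.integral_const_mul, intervalIntegral.integral_comp_neg (K ((l ^ α)⁻¹)), neg_neg]
  simp only [circleKernelIntegral, hinv, hK]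

/-! ### Locating the poles; the identity for λ < 1 -/

theorem cos_mul_pi_ne_one {α : ℝ} (hα : 0 < α) (h : ¬ ∃ k : ℕ, 1 ≤ k ∧ α / 2 = k) :
    Real.cos (α * π) ≠ 1 := by
  intro hc
  obtain ⟨k, hk⟩ := (Real.cos_eq_one_iff _).1 hc
  have h1 : α / 2 = k := by
    have := mul_right_cancel₀ Real.pi_pos.ne' (by linarith : (2 * (k : ℝ)) * π = α * π)
    linarith
  have hk0 : 0 < k := by
    have : (0 : ℝ) < k := by rw [← h1]; positivity
    exact_mod_cast this
  refine h ⟨k.toNat, by omega, ?_⟩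
  rw [h1]
  exact_mod_cast (Int.toNat_of_nonneg hk0.le).symm

/-- Argument π would force e^{iαπ} = 1. This keeps the poles off the edges of the slit. -/
theorem abs_arg_lt_pi_of_mem_unitPowerRoots {α : ℝ} (hα : 0 < α) (hcos : Real.cos (α * π) ≠ 1)
    {ω : ℂ} (hω : ω ∈ unitPowerRoots α) : |ω.arg| < π := by
  have h1 : ω.arg ≠ π := by
    intro h
    have h2 := hω.2
    rw [Complex.cpow_def_of_ne_zero hω.1, Complex.log, norm_eq_one_of_mem_unitPowerRoots hα hω, h,
      Real.log_one] at h2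
    have h3 := congrArg Complex.re h2
    rw [show (((0 : ℝ) : ℂ) + π * Complex.I) * α = ((α * π : ℝ) : ℂ) * Complex.I by
      push_cast; ring, Complex.exp_ofReal_mul_I_re] at h3
    exact hcos h3
  exact abs_lt.2 ⟨Complex.neg_pi_lt_arg ω, lt_of_le_of_ne (Complex.arg_le_pi ω) h1⟩

/-- The formula for the error term through cut densities, for every positive `α`
that is not an even integer. -/
noncomputable def cutError (α : ℝ) (n : ℕ) (l : ℝ) : ℝ :=
  α * Real.sin (α * π) / π * (l ^ α * (∫ t in (0 : ℝ)..1, cutDensity α (α * n) l t) +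
    l ^ (α * n) * (l⁻¹ ^ α * ∫ t in (0 : ℝ)..1, cutDensity α (α * n) l⁻¹ t))

theorem re_eq_log_of_exp_mul_eq_rpow {α μ : ℝ} (hα : 0 < α) (hμ : 0 < μ) (w : ℂ)
    (h : Complex.exp (α * w) = (μ ^ α : ℝ)) : w.re = Real.log μ := by
  have h1 := congrArg norm h
  rw [Complex.norm_exp, Complex.norm_real, Real.norm_of_nonneg (Real.rpow_nonneg hμ.le _),
    Complex.re_ofReal_mul, Real.rpow_def_of_pos hμ, Real.exp_eq_exp, mul_comm] at h1
  exact mul_right_cancel₀ hα.ne' h1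

/-- Every pole would have real part log μ > 0, outside the half strip, so no residues occur. -/
theorem circleKernelIntegral_of_one_lt {α b μ : ℝ} (hα : 0 < α) (hb : 0 < b) (hμ : 1 < μ)
    (hcos : Real.cos (α * π) ≠ 1) :
    circleKernelIntegral α b μ =
      -((2 * α * μ ^ α * Real.sin (α * π) * ∫ t in (0 : ℝ)..1, cutDensity α b μ t : ℝ) : ℂ) := by
  rw [circleKernelIntegral_eq hα hb (by linarith) hcos ∅ (by simp) (by
    intro w hw h
    have h1 := re_eq_log_of_exp_mul_eq_rpow hα (by linarith) w h
    have h2 := Real.log_pos hμ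
    exact absurd hw.1 (by rw [h1]; linarith))]
  simp

/-- The poles in the strip are exactly log(λω) = log λ + i arg ω for ω in K_α, and the residue there
is (1 + λω)^{αn}. -/
theorem circleKernelIntegral_of_lt_one {α : ℝ} {n : ℕ} {l : ℝ} (hα : 0 < α) (hb : 0 < α * n)
    (hl0 : 0 < l) (hl1 : l < 1) (hcos : Real.cos (α * π) ≠ 1) :
    circleKernelIntegral α (α * n) l = 2 * π * unitPowerRootSum α n l -
      ((2 * α * l ^ α * Real.sin (α * π) *
        ∫ t in (0 : ℝ)..1, cutDensity α (α * n) l t : ℝ) : ℂ) := by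
  classical
  have hpi := Real.pi_pos
  set K := (unitPowerRoots_finite hα).toFinset with hKdef
  have hlc : (l : ℂ) ≠ 0 := by exact_mod_cast hl0.ne'
  have hmem : ∀ ω ∈ K, ω ∈ unitPowerRoots α := fun ω hω => by simpa [hKdef] using hω
  have hlog : ∀ ω ∈ K, Complex.log (l * ω) = Real.log l + ω.arg * Complex.I := by
    intro ω hω
    rw [Complex.log_ofReal_mul hl0 (hmem ω hω).1, Complex.log,
      norm_eq_one_of_mem_unitPowerRoots hα (hmem ω hω)]
    simp
  have hexplog : ∀ ω ∈ K, Complex.exp (Complex.log (l * ω)) = l * ω := fun ω hω =>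
    Complex.exp_log (mul_ne_zero hlc (hmem ω hω).1)
  rw [circleKernelIntegral_eq hα hb hl0 hcos (K.image fun ω => Complex.log (l * ω)) ?_ ?_,
    Finset.sum_image]
  · congr 2
    rw [unitPowerRootSum, finsum_mem_eq_finite_toFinset_sum _ (unitPowerRoots_finite hα)]
    refine Finset.sum_congr rfl fun ω hω => ?_
    rw [onePlusExpPow, hexplog ω hω]
  · intro a ha b hb hab
    have := congrArg Complex.exp hab
    rw [hexplog a ha, hexplog b hb] at this
    exact mul_left_cancel₀ hlc this
  · intro s hs
    obtain ⟨ω, hω, rfl⟩ := Finset.mem_image.1 hs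
    refine ⟨⟨?_, ?_⟩, ?_⟩
    · rw [hlog ω hω]
      simpa using Real.log_neg hl0 hl1
    · rw [hlog ω hω]
      simpa using abs_arg_lt_pi_of_mem_unitPowerRoots hα hcos (hmem ω hω)
    · have h1 := (hmem ω hω).2
      rw [Complex.cpow_def_of_ne_zero (hmem ω hω).1, Complex.log,
        norm_eq_one_of_mem_unitPowerRoots hα (hmem ω hω), Real.log_one, Complex.ofReal_zero,
        zero_add] at h1
      rw [hlog ω hω, mul_add, Complex.exp_add, mul_comm (α : ℂ) (ω.arg * Complex.I), h1, mul_one,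
        Real.rpow_def_of_pos hl0]
      push_cast
      rw [mul_comm]
  · intro w hw h
    have hre := re_eq_log_of_exp_mul_eq_rpow hα hl0 w h
    have hw2 := abs_le.1 hw.2
    have hw' : w = Real.log l + w.im * Complex.I := by
      rw [← hre, Complex.re_add_im]
    have him : Complex.exp (w.im * α * Complex.I) = 1 := by
      rw [hw', mul_add, Complex.exp_add, Real.rpow_def_of_pos hl0] at h
      push_cast at h
      rw [mul_comm ((Real.log l : ℝ) : ℂ)] at h
      have := mul_left_cancel₀ (Complex.exp_ne_zero _) (h.trans (mul_one _).symm)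
      rw [← this]
      congr 1
      ring
    have hne : w.im ≠ -π := by
      intro hwi
      rw [hwi] at him
      have h3 := congrArg Complex.re him
      rw [← Complex.ofReal_mul, Complex.exp_ofReal_mul_I_re] at h3
      rw [show -π * α = -(α * π) by ring, Real.cos_neg] at h3
      exact hcos h3
    have hgt : -π < w.im := lt_of_le_of_ne hw2.1 (Ne.symm hne)
    have hωK : Complex.exp (w.im * Complex.I) ∈ K := by
      rw [hKdef, Set.Finite.mem_toFinset, mem_unitPowerRoots_iff hα]
      exact ⟨w.im, hgt, hw2.2, rfl, him⟩
    refine Finset.mem_image.2 ⟨_, hωK, ?_⟩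
    rw [Complex.log_ofReal_mul hl0 (Complex.exp_ne_zero _),
      Complex.log_exp (by simpa using hgt) (by simpa using hw2.2)]
    exact hw'.symm

/-- The fractional binomial identity away from the endpoint `l = 1`. -/
theorem fracBinomSum_eq_of_lt_one {α : ℝ} (hα : 0 < α) {n : ℕ} (hn : 1 ≤ n) {l : ℝ}
    (hl0 : 0 < l) (hl1 : l < 1) (hcos : Real.cos (α * π) ≠ 1) :
    (fracBinomSum α n l : ℂ) = unitPowerRootSum α n l - (cutError α n l : ℂ) := by
  have hn' : (1 : ℝ) ≤ n := by exact_mod_cast hn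
  have hb : 0 < α * n := by positivity
  have h := fracBinomSum_eq_circleKernelIntegral hα hn hl0 hl1
  rw [circleKernelIntegral_of_lt_one hα hb hl0 hl1 hcos,
    circleKernelIntegral_of_one_lt hα hb ((one_lt_inv₀ hl0).2 hl1) hcos] at h
  have hpi : (π : ℂ) ≠ 0 := by exact_mod_cast Real.pi_pos.ne'
  have h2 : (2 * π : ℂ) ≠ 0 := mul_ne_zero two_ne_zero hpi
  apply mul_left_cancel₀ h2
  rw [h, cutError]
  push_cast
  field_simp
  ring

/-! ### The endpoint λ = 1 by continuity -/

theorem continuousAt_cutError {α : ℝ} (hα : 0 < α) (n : ℕ) {l : ℝ} (hl : 0 < l)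
    (hcos : Real.cos (α * π) ≠ 1) : ContinuousAt (cutError α n) l := by
  have hb : 0 ≤ α * n := by positivity
  have hinv : ContinuousAt (fun x : ℝ => x⁻¹) l := continuousAt_inv₀ hl.ne'
  have h1 := continuousAt_integral_cutDensity hα hb hl hcos
  have h2 : ContinuousAt (fun x : ℝ => ∫ t in (0 : ℝ)..1, cutDensity α (α * n) x⁻¹ t) l :=
    ContinuousAt.comp (f := fun x : ℝ => x⁻¹)
      (continuousAt_integral_cutDensity hα hb (inv_pos.2 hl) hcos) hinv
  have h3 : ∀ p : ℝ, ContinuousAt (fun x : ℝ => x ^ p) l := fun p =>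
    Real.continuousAt_rpow_const l p (Or.inl hl.ne')
  have h4 : ContinuousAt (fun x : ℝ => x⁻¹ ^ α) l :=
    ContinuousAt.comp (f := fun x : ℝ => x⁻¹)
      (Real.continuousAt_rpow_const l⁻¹ α (Or.inl (inv_pos.2 hl).ne')) hinv
  exact continuousAt_const.mul (((h3 _).mul h1).add ((h3 _).mul (h4.mul h2)))

theorem continuousAt_fracBinomSum (α : ℝ) (n : ℕ) {l : ℝ} (hl : 0 < l) :
    ContinuousAt (fracBinomSum α n) l :=
  continuousAt_const.mul (tendsto_finsetSum _ fun j _ =>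
    continuousAt_const.mul (Real.continuousAt_rpow_const l (α * j) (Or.inl hl.ne')))

/-- Since |ω| = 1 and 0 ≤ λ ≤ 1, each base has nonnegative real part, where a power with positive
exponent is continuous, even at base 0. -/
theorem continuousAt_unitPowerRootSum {α : ℝ} (hα : 0 < α) {n : ℕ} (hb : 0 < α * n) {l : ℝ}
    (hl0 : 0 ≤ l) (hl1 : l ≤ 1) : ContinuousAt (unitPowerRootSum α n) l := by
  have e : unitPowerRootSum α n = fun l : ℝ => ∑ ω ∈ (unitPowerRoots_finite hα).toFinset,
      (1 + (l : ℂ) * ω) ^ ((α * n : ℝ) : ℂ) := by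
    ext l
    exact finsum_mem_eq_finite_toFinset_sum _ (unitPowerRoots_finite hα)
  rw [e]
  refine tendsto_finsetSum _ fun ω hω => ?_
  have hω' : ω ∈ unitPowerRoots α := by simpa using hω
  have hre := (abs_le.1 (Complex.abs_re_le_norm ω)).1
  rw [norm_eq_one_of_mem_unitPowerRoots hα hω'] at hre
  have h := Complex.continuousAt_cpow_const_of_re_pos (z := 1 + (l : ℂ) * ω)
    (w := ((α * n : ℝ) : ℂ)) (Or.inl (by
      simp only [Complex.add_re, Complex.one_re, Complex.re_ofReal_mul]
      nlinarith)) (by rwa [Complex.ofReal_re])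
  exact ContinuousAt.comp (f := fun l : ℝ => 1 + (l : ℂ) * ω) h (by fun_prop)

theorem fracBinomSum_eq_sub_cutError {α : ℝ} (hα : 0 < α) {n : ℕ} (hn : 1 ≤ n) {l : ℝ}
    (hl0 : 0 < l) (hl1 : l ≤ 1) (hcos : Real.cos (α * π) ≠ 1) :
    (fracBinomSum α n l : ℂ) = unitPowerRootSum α n l - (cutError α n l : ℂ) := by
  have hn' : (1 : ℝ) ≤ n := by exact_mod_cast hn
  have hb : 0 < α * n := by positivity
  rcases hl1.lt_or_eq with h | rfl
  · exact fracBinomSum_eq_of_lt_one hα hn hl0 h hcos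
  · have h1 : Filter.Tendsto (fun l => (fracBinomSum α n l : ℂ)) (nhdsWithin 1 (Set.Iio 1))
        (nhds (fracBinomSum α n 1 : ℂ)) :=
      ((Complex.continuous_ofReal.tendsto _).comp
        (continuousAt_fracBinomSum α n one_pos).tendsto).mono_left nhdsWithin_le_nhds
    have h2 : Filter.Tendsto (fun l => unitPowerRootSum α n l - (cutError α n l : ℂ))
        (nhdsWithin 1 (Set.Iio 1)) (nhds (unitPowerRootSum α n 1 - (cutError α n 1 : ℂ))) :=
      ((continuousAt_unitPowerRootSum hα hb zero_le_one le_rfl).tendsto.sub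
        ((Complex.continuous_ofReal.tendsto _).comp
          (continuousAt_cutError hα n one_pos hcos).tendsto)).mono_left nhdsWithin_le_nhds
    refine tendsto_nhds_unique h1 (h2.congr' ?_)
    filter_upwards [Ioo_mem_nhdsLT one_pos] with x hx
    exact (fracBinomSum_eq_of_lt_one hα hn hx.1 hx.2 hcos).symm

/-! ### The error integral: closed form, convergence, positivity -/

theorem errorIntegrand_eq {α : ℝ} (n : ℕ) {l t : ℝ} (hl : 0 < l) (ht : 0 ≤ t) :
    l ^ α * errorIntegrand α n l t = l ^ α * cutDensity α (α * n) l t +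
      l ^ (α * n) * (l⁻¹ ^ α * cutDensity α (α * n) l⁻¹ t) := by
  have hm : 0 < l ^ α := Real.rpow_pos_of_pos hl _
  -- Both squared norms depend only on two moduli and cos(απ), so the roles of the summands may be
  -- exchanged and λ^α factored out.
  have hswap : ‖Complex.exp (-(Complex.I * α * π)) - (((l * t) ^ α : ℝ) : ℂ)‖ ^ 2 =
      (l ^ α) ^ 2 * ‖((t ^ α : ℝ) : ℂ) -
        ((l⁻¹ ^ α : ℝ) : ℂ) * Complex.exp (-(Complex.I * α * π))‖ ^ 2 := by
    have h1 := norm_sub_mul_exp_sq α ((l * t) ^ α) 1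
    rw [Complex.ofReal_one, one_mul] at h1
    rw [norm_sub_rev, h1, norm_sub_mul_exp_sq, Real.mul_rpow hl.le ht, Real.inv_rpow hl.le]
    field_simp
  unfold errorIntegrand cutDensity
  rw [hswap]
  rw [Real.inv_rpow hl.le]
  -- No condition on α excludes a vanishing denominator here; in that case both sides agree because
  -- x / 0 = 0.
  by_cases hz : ‖((t ^ α : ℝ) : ℂ) -
        (((l ^ α)⁻¹ : ℝ) : ℂ) * Complex.exp (-(Complex.I * α * π))‖ ^ 2 = 0
  · rw [hz]
    simp only [mul_zero, div_zero, add_zero]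
    ring
  · field_simp

theorem intervalIntegrable_errorIntegrand {α : ℝ} (hα : 0 < α) (n : ℕ) {l : ℝ} (hl : 0 < l)
    (hcos : Real.cos (α * π) ≠ 1) : IntervalIntegrable (errorIntegrand α n l) volume 0 1 := by
  have hb : 0 ≤ α * n := by positivity
  have hm : l ^ α ≠ 0 := (Real.rpow_pos_of_pos hl _).ne'
  have h := (((intervalIntegrable_cutDensity hα hb hl hcos).const_mul (l ^ α)).add
    (((intervalIntegrable_cutDensity hα hb (inv_pos.2 hl) hcos).const_mul (l⁻¹ ^ α)).const_mul
      (l ^ (α * n)))).const_mul (l ^ α)⁻¹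
  refine h.congr fun t ht => ?_
  rw [Set.uIoc_of_le zero_le_one] at ht
  rw [← errorIntegrand_eq n hl ht.1.le, inv_mul_cancel_left₀ hm]

theorem cutError_eq_integral {α : ℝ} (hα : 0 < α) (n : ℕ) {l : ℝ} (hl : 0 < l)
    (hcos : Real.cos (α * π) ≠ 1) :
    cutError α n l =
      α * l ^ α * Real.sin (α * π) / π * ∫ t in (0 : ℝ)..1, errorIntegrand α n l t := by
  have hb : 0 ≤ α * n := by positivity
  have h : l ^ α * ∫ t in (0 : ℝ)..1, errorIntegrand α n l t =
      l ^ α * (∫ t in (0 : ℝ)..1, cutDensity α (α * n) l t) +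
      l ^ (α * n) * (l⁻¹ ^ α * ∫ t in (0 : ℝ)..1, cutDensity α (α * n) l⁻¹ t) := by
    simp only [← intervalIntegral.integral_const_mul]
    rw [← intervalIntegral.integral_add
      ((intervalIntegrable_cutDensity hα hb hl hcos).const_mul _)
      (((intervalIntegrable_cutDensity hα hb (inv_pos.2 hl) hcos).const_mul _).const_mul _)]
    refine intervalIntegral.integral_congr fun t ht => ?_
    rw [Set.uIcc_of_le zero_le_one] at ht
    exact errorIntegrand_eq n hl ht.1
  rw [cutError, ← h]
  ring

theorem integral_errorIntegrand_pos {α : ℝ} (hα : 0 < α) (n : ℕ) {l : ℝ} (hl : 0 < l)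
    (hcos : Real.cos (α * π) ≠ 1) : 0 < ∫ t in (0 : ℝ)..1, errorIntegrand α n l t := by
  refine intervalIntegral.intervalIntegral_pos_of_pos_on
    (intervalIntegrable_errorIntegrand hα n hl hcos) (fun t ht => ?_) one_pos
  have h1 := norm_sub_mul_exp_sq_pos hcos (Real.rpow_nonneg ht.1.le α) (Real.rpow_pos_of_pos hl α)
  have ht0 := ht.1
  have ht1 := sub_pos.2 ht.2
  unfold errorIntegrand
  positivity

/-! ### Integer α -/

/-- The identity for integer `α`, from the binomial theorem and orthogonality of characters. -/
theorem fracBinomSum_natCast {k : ℕ} (hk : 0 < k) (n : ℕ) (l : ℝ) :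
    (fracBinomSum k n l : ℂ) = unitPowerRootSum k n l := by
  classical
  have hk0 : (0 : ℝ) < k := by exact_mod_cast hk
  set K := (unitPowerRoots_finite hk0).toFinset with hKdef
  have hmem : ∀ ω : ℂ, ω ∈ K ↔ ω ^ k = 1 := by
    intro ω
    rw [hKdef, Set.Finite.mem_toFinset, unitPowerRoots, Set.mem_ofPred_eq, Complex.ofReal_natCast,
      Complex.cpow_natCast]
    refine ⟨fun h => h.2, fun h => ⟨?_, h⟩⟩
    rintro rfl
    rw [zero_pow hk.ne'] at h
    exact zero_ne_one h
  have hprim := Complex.isPrimitiveRoot_exp k hk.ne'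
  set ζ := Complex.exp (2 * π * Complex.I / k) with hζ
  have hcard : K.card = k := by
    have : K = Polynomial.nthRootsFinset k (1 : ℂ) := by
      ext ω
      rw [hmem, Polynomial.mem_nthRootsFinset hk]
    rw [this, hprim.card_nthRootsFinset]
  have horth : ∀ i : ℕ, ∑ ω ∈ K, ω ^ i = if k ∣ i then (k : ℂ) else 0 := by
    intro i
    split_ifs with h
    · obtain ⟨j, rfl⟩ := h
      rw [Finset.sum_congr rfl fun ω hω => by rw [pow_mul, (hmem ω).1 hω, one_pow]]
      simp [hcard]
    · have hne : ζ ^ i ≠ 1 := fun h' => h ((hprim.pow_eq_one_iff_dvd i).1 h')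
      have hζ0 : ζ ≠ 0 := Complex.exp_ne_zero _
      -- Multiplication by ζ permutes the roots, so the power sum is fixed by the factor ζ^i ≠ 1 and
      -- must vanish.
      have hs : ∑ ω ∈ K, ω ^ i = ζ ^ i * ∑ ω ∈ K, ω ^ i := by
        rw [Finset.mul_sum]
        symm
        refine Finset.sum_bij' (fun ω _ => ζ * ω) (fun ω _ => ζ⁻¹ * ω) ?_ ?_ ?_ ?_ ?_
        · intro ω hω
          rw [hmem] at hω ⊢
          rw [mul_pow, hω, hprim.pow_eq_one, one_mul]
        · intro ω hω
          rw [hmem] at hω ⊢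
          rw [mul_pow, hω, inv_pow, hprim.pow_eq_one, inv_one, one_mul]
        · intro ω _
          exact inv_mul_cancel_left₀ hζ0 ω
        · intro ω _
          exact mul_inv_cancel_left₀ hζ0 ω
        · intro ω _
          rw [mul_pow]
      have h0 : (ζ ^ i - 1) * ∑ ω ∈ K, ω ^ i = 0 := by linear_combination -hs
      exact (mul_eq_zero.1 h0).resolve_left (sub_ne_zero.2 hne)
  have hG : ∀ j ∈ Finset.range (n + 1), gammaChoose ((k : ℝ) * n) (k * j) * l ^ ((k : ℝ) * j) =
      ((k * n).choose (k * j) : ℝ) * l ^ (k * j) := by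
    intro j hj
    have hjn : k * j ≤ k * n :=
      Nat.mul_le_mul_left k (Nat.lt_succ_iff.1 (Finset.mem_range.1 hj))
    have e1 : (k : ℝ) * n - k * j + 1 = ((k * n - k * j : ℕ) : ℝ) + 1 := by
      rw [Nat.cast_sub hjn]; push_cast; ring
    rw [gammaChoose, e1, Real.Gamma_nat_eq_factorial, ← Nat.cast_mul, ← Nat.cast_mul,
      Real.Gamma_nat_eq_factorial, Real.Gamma_nat_eq_factorial, Real.rpow_natCast,
      Nat.cast_choose ℝ hjn]
  have hU : unitPowerRootSum k n l = ∑ ω ∈ K, (1 + (l : ℂ) * ω) ^ (k * n) := by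
    rw [unitPowerRootSum, finsum_mem_eq_finite_toFinset_sum _ (unitPowerRoots_finite hk0)]
    refine Finset.sum_congr rfl fun ω _ => ?_
    rw [← Nat.cast_mul, Complex.ofReal_natCast, Complex.cpow_natCast]
  rw [hU, fracBinomSum, Finset.sum_congr rfl hG]
  have hexp : ∀ ω ∈ K, (1 + (l : ℂ) * ω) ^ (k * n) = ∑ i ∈ Finset.range (k * n + 1),
      ((k * n).choose i : ℂ) * (l : ℂ) ^ i * ω ^ i := by
    intro ω _
    rw [add_comm, add_pow]
    refine Finset.sum_congr rfl fun i _ => ?_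
    rw [one_pow, mul_pow]
    ring
  rw [Finset.sum_congr rfl hexp, Finset.sum_comm]
  simp_rw [← Finset.mul_sum, horth, mul_ite, mul_zero]
  rw [← Finset.sum_filter]
  have himg : (Finset.range (k * n + 1)).filter (k ∣ ·) =
      (Finset.range (n + 1)).image (k * ·) := by
    ext i
    simp only [Finset.mem_filter, Finset.mem_range, Finset.mem_image]
    constructor
    · rintro ⟨h1, j, rfl⟩
      exact ⟨j, Nat.lt_succ_of_le (Nat.le_of_mul_le_mul_left (Nat.lt_succ_iff.1 h1) hk), rfl⟩
    · rintro ⟨j, hj, rfl⟩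
      exact ⟨Nat.lt_succ_of_le (Nat.mul_le_mul_left k (Nat.lt_succ_iff.1 hj)), Dvd.intro _ rfl⟩
  rw [himg, Finset.sum_image fun a _ b _ h => Nat.eq_of_mul_eq_mul_left hk h]
  push_cast
  rw [Finset.mul_sum]
  exact Finset.sum_congr rfl fun j _ => by ring

/-! ### Signs and assembly -/

theorem sin_mul_pi_pos {α : ℝ} {m : ℕ} (h1 : 2 * (m : ℝ) < α) (h2 : α < 2 * m + 1) :
    0 < Real.sin (α * π) := by
  have hpi := Real.pi_pos
  rw [← Real.sin_sub_nat_mul_two_pi _ m]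
  apply Real.sin_pos_of_pos_of_lt_pi <;> nlinarith

theorem sin_mul_pi_neg {α : ℝ} {m : ℕ} (h1 : 2 * (m : ℝ) + 1 < α) (h2 : α < 2 * m + 2) :
    Real.sin (α * π) < 0 := by
  have hpi := Real.pi_pos
  rw [← Real.sin_sub_nat_mul_two_pi _ (m + 1)]
  apply Real.sin_neg_of_neg_of_neg_pi_lt <;> push_cast <;> nlinarith

theorem fracBinomSum_eq_sub_errorTerm {α : ℝ} (hα : 0 < α) {n : ℕ} (hn : 1 ≤ n) {l : ℝ}
    (hl0 : 0 < l) (hl1 : l ≤ 1) :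
    (fracBinomSum α n l : ℂ) = unitPowerRootSum α n l - (errorTerm α n l : ℂ) := by
  by_cases h : ∃ k : ℕ, 1 ≤ k ∧ α / 2 = k
  · obtain ⟨k, hk, hk2⟩ := id h
    -- Even α, where a pole lies on the slit: the error term is zero by convention and the algebraic
    -- identity applies.
    have hα2 : α = ((2 * k : ℕ) : ℝ) := by push_cast; linarith
    rw [errorTerm, if_pos h, Complex.ofReal_zero, sub_zero, hα2]
    exact fracBinomSum_natCast (by omega) n l
  · have hcos := cos_mul_pi_ne_one hα h
    rw [errorTerm, if_neg h, ← cutError_eq_integral hα n hl0 hcos]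
    exact fracBinomSum_eq_sub_cutError hα hn hl0 hl1 hcos

theorem errorTerm_natCast (k n : ℕ) (l : ℝ) : errorTerm k n l = 0 := by
  rw [errorTerm]
  split_ifs
  · rfl
  · rw [Real.sin_nat_mul_pi]; simp

theorem not_even_of_sin_ne_zero {α : ℝ} (h : Real.sin (α * π) ≠ 0) :
    ¬ ∃ k : ℕ, 1 ≤ k ∧ α / 2 = k := by
  rintro ⟨k, -, hk⟩
  apply h
  rw [show α = ((2 * k : ℕ) : ℝ) by push_cast; linarith, Real.sin_nat_mul_pi]

/-- The error term is a positive multiple of `sin (απ)`. -/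
theorem exists_errorTerm_eq_mul_sin {α : ℝ} (hα : 0 < α) (n : ℕ) {l : ℝ} (hl : 0 < l)
    (h : Real.sin (α * π) ≠ 0) : ∃ c > 0, errorTerm α n l = c * Real.sin (α * π) := by
  have he := not_even_of_sin_ne_zero h
  have hI := integral_errorIntegrand_pos hα n hl (cos_mul_pi_ne_one hα he)
  have hm := Real.rpow_pos_of_pos hl α
  refine ⟨α * l ^ α / π * ∫ t in (0 : ℝ)..1, errorIntegrand α n l t, by positivity, ?_⟩
  rw [errorTerm, if_neg he]
  ring

theorem theorem3p2 (α : ℝ) (hα : 0 < α) (n : ℕ) (hn : 1 ≤ n) (l : ℝ) (hl0 : 0 < l)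
    (hl1 : l ≤ 1) :
    -- the integral in the error term converges whenever it is used
    ((¬ ∃ k : ℕ, 1 ≤ k ∧ α / 2 = k) →
      IntervalIntegrable (errorIntegrand α n l) volume 0 1) ∧
    -- the identity
    (fracBinomSum α n l : ℂ) = unitPowerRootSum α n l - (errorTerm α n l : ℂ) ∧
    -- the sum over the roots is real, and the sign of the difference
    (unitPowerRootSum α n l).im = 0 ∧
    ((∃ m : ℕ, 2 * (m : ℝ) < α ∧ α < 2 * m + 1) →
      fracBinomSum α n l - (unitPowerRootSum α n l).re < 0) ∧
    ((∃ k : ℕ, α = k) →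
      fracBinomSum α n l - (unitPowerRootSum α n l).re = 0) ∧
    ((∃ m : ℕ, 2 * (m : ℝ) + 1 < α ∧ α < 2 * m + 2) →
      0 < fracBinomSum α n l - (unitPowerRootSum α n l).re) := by
  have hid := fracBinomSum_eq_sub_errorTerm hα hn hl0 hl1
  have hU : unitPowerRootSum α n l = ((fracBinomSum α n l + errorTerm α n l : ℝ) : ℂ) := by
    push_cast
    rw [hid]
    ring
  have hdiff : fracBinomSum α n l - (unitPowerRootSum α n l).re = -errorTerm α n l := by
    rw [hU, Complex.ofReal_re]
    ring
  refine ⟨fun h => intervalIntegrable_errorIntegrand hα n hl0 (cos_mul_pi_ne_one hα h), hid,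
    by rw [hU, Complex.ofReal_im], ?_, ?_, ?_⟩
  · rintro ⟨m, h1, h2⟩
    have hs := sin_mul_pi_pos h1 h2
    obtain ⟨c, hc, he⟩ := exists_errorTerm_eq_mul_sin hα n hl0 hs.ne'
    rw [hdiff, he]
    exact neg_neg_of_pos (mul_pos hc hs)
  · rintro ⟨k, rfl⟩
    rw [hdiff, errorTerm_natCast, neg_zero]
  · rintro ⟨m, h1, h2⟩
    have hs := sin_mul_pi_neg h1 h2
    obtain ⟨c, hc, he⟩ := exists_errorTerm_eq_mul_sin hα n hl0 hs.ne
    rw [hdiff, he]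
    exact neg_pos.2 (mul_neg_of_pos_of_neg hc hs)
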